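/- Setting. There are $N\ge 2$ workers on a strongly connected directed graph; $\mathcal N_i$ denotes the set of workers with an edge to $i$, together with $i$ itself. Let $P=(P_{ij})$ be a nonnegative doubly stochastic $N\times N$ matrix with $P_{ij}>0$ exactly when $j\in\mathcal N_i$; put $p=\min\{P_{ij}: P_{ij}>0\}$, $C=\frac{2(1+p^{-N})}{1-p^N}$ and $q=(1-p^N)^{1/N}$. Worker $i$ holds a finite dataset $\mathcal D_i$ and has local loss $F_i(\phi,\theta)=\frac1{|\mathcal D_i|}\sum_{(x,y)\in\mathcal D_i}\ell(\theta\circ\phi;x,y)$, where $\phi\in\mathbb R^a$ and $\theta\in\mathbb R^b$ are the parameter vectors of the shared representation and of the worker's head; each $\ell(\theta\circ\phi;x,y)$ is differentiable in $\phi$ and in $\theta$ separately. Let $f(\phi,\{\theta_i\})=\frac1N\sum_i F_i(\phi,\theta_i)$, $\nabla_\phi f(\phi,\{\theta_i\})=\frac1N\sum_i\nabla_\phi F_i(\phi,\theta_i)$ and $\nabla_\theta f(\phi,\{\theta_i\})=\frac1N\sum_i\nabla_\theta F_i(\phi,\theta_i)$. Algorithm (DePRL). Start from $\phi_i(0)=\phi(0)$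 for all $i$ and heads $\theta_i(0)$ (deterministic). In round $k$, every worker $i$ sets $\theta_i(k,0)=\theta_i(k)$, performs $\theta_i(k,s+1)=\theta_i(k,s)-\alpha\, g_\theta(\phi_i(k),\theta_i(k,s))$ for $s=0,\dots,\tau-1$ (where $\tau\ge1$), sets $\theta_i(k+1)=\theta_i(k,\tau)$, then $\phi_i(k+\tfrac12)=\phi_i(k)-\beta\, g_\phi(\phi_i(k),\theta_i(k+1))$ and $\phi_i(k+1)=\sum_{j\in\mathcal N_i}P_{ij}\,\phi_j(k+\tfrac12)$. Here $g_\theta,g_\phi$ are averages of per-example gradients over random nonempty mini-batches of $\mathcal D_i$, all mini-batches (across workers, rounds and steps) being independent. Assumptions. For constants $L,\sigma,\varsigma>0$: for all $i,\phi,\phi',\theta,\theta'$, both $\|\nabla_\phi F_i(\phi,\theta)-\nabla_\phi F_i(\phi',\theta')\|$ and $\|\nabla_\theta F_i(\phi,\theta)-\nabla_\theta F_i(\phi',\theta')\|$ are at most $L(\|\phi-\phi'\|+\|\theta-\theta'\|)$; for fixed $(\phi,\theta)$ the stochastic gradients $g_\phi,g_\theta$ of worker $i$ have means $\nabla_\phi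 F_i(\phi,\theta)$, $\nabla_\theta F_i(\phi,\theta)$ and variances at most $\sigma^2$; and $\frac1N\sum_i\|\nabla_\phi F_i(\phi,\theta_i)-\nabla_\phi f(\phi,\{\theta_j\})\|^2\le\varsigma^2$ for all $\phi,\{\theta_i\}$. Finally $f^*:=\inf f>-\infty$ and $f(\phi(0),\{\theta_i(0)\})-f^*\le\Delta$. Corollary 1. Let $\alpha=\frac1{\tau\sqrt K}$ and $\beta=\sqrt{N/K}$, and with $\bar\phi(k)=\frac1N\sum_i\phi_i(k)$ let $$M(k)=\|\nabla_\phi f(\bar\phi(k),\{\theta_i(k+1)\})\|^2+\frac{\alpha\tau}{\beta}\|\nabla_\theta f(\bar\phi(k),\{\theta_i(k)\})\|^2+\frac1N\sum_{i=1}^N\|\phi_i(k)-\bar\phi(k)\|^2 .$$ There is a constant $c>0$ depending only on $L,\sigma,\varsigma,\Delta$ such that, whenever $$K\ge\max\left(\frac{18C^2L^2N^3}{(1-q)^2},\ \frac{(2L^2+2)^2}{NL^4},\ NL^2\right),$$ each $M(k)$, $k<K$, is integrable and $$\frac1K\sum_{k=0}^{K-1}\mathbb E[M(k)]\le c\left(\frac1{\sqrt{NK}}+\frac1{K\sqrt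 N}+\frac1{\tau\sqrt{NK}}\right).$$ In particular the left-hand side is at most $3c/\sqrt{NK}$ with $c$ independent of $N$, that is, there is a linear speedup in the number of workers. -/

import Mathlib

open MeasureTheory ProbabilityTheory

noncomputable section

namespace DePRL

/-- Parameter vectors, with the Euclidean norm. -/
abbrev Vec (n : ℕ) : Type := EuclideanSpace ℝ (Fin n)

/-- A personalized learning problem with `N` workers. The global representation, with parameter in
`ℝ^a`, maps inputs `X` to features `Z`; a local head, with parameter in `ℝ^b`, maps features to
predictions `W`; `err` compares a prediction with a label in `Y`. Worker `i` holds the finite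
dataset `data i` of `size i` examples. -/
structure Problem (N a b : ℕ) (X Z W Y : Type*) where
  rep : Vec a → X → Z
  head : Vec b → Z → W
  err : W → Y → ℝ
  size : Fin N → ℕ
  data : (i : Fin N) → Fin (size i) → X × Y

namespace Problem

variable {N a b : ℕ} {X Z W Y : Type*} (Q : Problem N a b X Z W Y)

/-- The error of the model `θ ∘ φ` on the `m`-th example of worker `i`. -/
def sampleLoss (i : Fin N) (m : Fin (Q.size i)) (φ : Vec a) (θ : Vec b) : ℝ :=
  Q.err ((Q.head θ ∘ Q.rep φ) (Q.data i m).1) (Q.data i m).2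

/-- The local loss `F_i(φ, θ)`: average over the dataset of worker `i`. -/
def localLoss (i : Fin N) (φ : Vec a) (θ : Vec b) : ℝ :=
  (1 / (Q.size i : ℝ)) * ∑ m, Q.sampleLoss i m φ θ

/-- The global loss `f(φ, {θ_i}) = (1/N) ∑ F_i(φ, θ_i)`. -/
def globalLoss (φ : Vec a) (θ : Fin N → Vec b) : ℝ :=
  (1 / (N : ℝ)) * ∑ i, Q.localLoss i φ (θ i)

/-- `∇_φ F_i(φ, θ)`. -/
def gradRep (i : Fin N) (φ : Vec a) (θ : Vec b) : Vec a :=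
  gradient (fun φ' => Q.localLoss i φ' θ) φ

/-- `∇_θ F_i(φ, θ)`. -/
def gradHead (i : Fin N) (φ : Vec a) (θ : Vec b) : Vec b :=
  gradient (fun θ' => Q.localLoss i φ θ') θ

/-- `∇_φ f(φ, {θ_i}) = (1/N) ∑ ∇_φ F_i(φ, θ_i)`. -/
def globalGradRep (φ : Vec a) (θ : Fin N → Vec b) : Vec a :=
  (1 / (N : ℝ)) • ∑ i, Q.gradRep i φ (θ i)

/-- `∇_θ f(φ, {θ_i}) = (1/N) ∑ ∇_θ F_i(φ, θ_i)`. -/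
def globalGradHead (φ : Vec a) (θ : Fin N → Vec b) : Vec b :=
  (1 / (N : ℝ)) • ∑ i, Q.gradHead i φ (θ i)

/-- Stochastic gradient `g_φ` of worker `i` on the mini-batch `B`. -/
def batchGradRep (i : Fin N) (B : Finset (Fin (Q.size i))) (φ : Vec a) (θ : Vec b) : Vec a :=
  (1 / (B.card : ℝ)) • ∑ m ∈ B, gradient (fun φ' => Q.sampleLoss i m φ' θ) φ

/-- Stochastic gradient `g_θ` of worker `i` on the mini-batch `B`. -/
def batchGradHead (i : Fin N) (B : Finset (Fin (Q.size i))) (φ : Vec a) (θ : Vec b) : Vec b :=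
  (1 / (B.card : ℝ)) • ∑ m ∈ B, gradient (fun θ' => Q.sampleLoss i m φ θ') θ

/-- Each per-example loss has partial gradients in `φ` and in `θ` everywhere. -/
def PartiallyDifferentiable : Prop :=
  (∀ i m θ, Differentiable ℝ fun φ => Q.sampleLoss i m φ θ) ∧
  (∀ i m φ, Differentiable ℝ fun θ => Q.sampleLoss i m φ θ)

/-- `L`-Lipschitz partial gradients of every local loss. -/
def LipschitzGradients (L : ℝ) : Prop :=
  (∀ i φ φ' θ θ', ‖Q.gradRep i φ θ - Q.gradRep i φ' θ'‖ ≤ L * (‖φ - φ'‖ + ‖θ - θ'‖)) ∧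
  (∀ i φ φ' θ θ', ‖Q.gradHead i φ θ - Q.gradHead i φ' θ'‖ ≤ L * (‖φ - φ'‖ + ‖θ - θ'‖))

/-- Global variability of the local partial gradients in `φ` bounded by `ς²`. -/
def BoundedVariability (ς : ℝ) : Prop :=
  ∀ (φ : Vec a) (θ : Fin N → Vec b),
    (1 / (N : ℝ)) * ∑ i, ‖Q.gradRep i φ (θ i) - Q.globalGradRep φ θ‖ ^ 2 ≤ ς ^ 2

end Problem

/-- The random mini-batches: `headBatch i k s` is used by worker `i` in the local head step `s` of
round `k`, and `repBatch i k` in its representation step of round `k`. -/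
structure Batches {N a b : ℕ} {X Z W Y : Type*} (Q : Problem N a b X Z W Y) (Ω : Type*) where
  headBatch : (i : Fin N) → ℕ → ℕ → Ω → Finset (Fin (Q.size i))
  repBatch : (i : Fin N) → ℕ → Ω → Finset (Fin (Q.size i))

namespace Batches

variable {N a b : ℕ} {X Z W Y Ω : Type*} {Q : Problem N a b X Z W Y} (S : Batches Q Ω)

/-- All mini-batches as one family: worker, round, and local head step or (for `none`) the
representation step. -/
def family (τ : ℕ) : (j : Fin N × ℕ × Option (Fin τ)) → Ω → Finset (Fin (Q.size j.1))
  | (i, k, some s) => S.headBatch i k s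
  | (i, k, none) => S.repBatch i k

/-- The mini-batches are nonempty random subsets of the datasets, sampled independently across
workers, rounds and steps. -/
structure IsIndependentSampling [MeasurableSpace Ω] (μ : Measure Ω) (τ : ℕ) : Prop where
  measurable : ∀ j, Measurable[_, ⊤] (S.family τ j)
  nonempty : ∀ j ω, (S.family τ j ω).Nonempty
  indep : iIndepFun (m := fun _ => ⊤) (S.family τ) μ

/-- Unbiased stochastic gradients. -/
def Unbiased [MeasurableSpace Ω] (μ : Measure Ω) (τ : ℕ) : Prop :=
  (∀ i k φ θ, ∫ ω, Q.batchGradRep i (S.repBatch i k ω) φ θ ∂μ = Q.gradRep i φ θ) ∧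
  (∀ i k, ∀ s < τ, ∀ φ θ,
    ∫ ω, Q.batchGradHead i (S.headBatch i k s ω) φ θ ∂μ = Q.gradHead i φ θ)

/-- Variance of the stochastic gradients bounded by `σ²`. -/
def BoundedVariance [MeasurableSpace Ω] (μ : Measure Ω) (τ : ℕ) (σ : ℝ) : Prop :=
  (∀ i k φ θ,
    ∫ ω, ‖Q.batchGradRep i (S.repBatch i k ω) φ θ - Q.gradRep i φ θ‖ ^ 2 ∂μ ≤ σ ^ 2) ∧
  (∀ i k, ∀ s < τ, ∀ φ θ,
    ∫ ω, ‖Q.batchGradHead i (S.headBatch i k s ω) φ θ - Q.gradHead i φ θ‖ ^ 2 ∂μ ≤ σ ^ 2)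

end Batches

open Classical in
/-- The neighbours of worker `i`: those with an edge to `i`, and `i` itself. -/
def neighbors {N : ℕ} (G : Digraph (Fin N)) (i : Fin N) : Finset (Fin N) :=
  Finset.univ.filter fun j => G.Adj j i ∨ j = i

/-- There is a directed path between any two workers. -/
def StronglyConnected {N : ℕ} (G : Digraph (Fin N)) : Prop :=
  ∀ i j, Relation.ReflTransGen G.Adj i j

/-- A consensus matrix for `G`: (nonnegative and) doubly stochastic, with positive weights exactly
on the neighbours. -/
structure IsConsensusMatrix {N : ℕ} (G : Digraph (Fin N)) (P : Matrix (Fin N) (Fin N) ℝ) :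
    Prop where
  doublyStochastic : P ∈ doublyStochastic ℝ (Fin N)
  pos_iff : ∀ i j, 0 < P i j ↔ j ∈ neighbors G i

/-- `p`, the smallest positive entry of the consensus matrix. -/
def minWeight {N : ℕ} (P : Matrix (Fin N) (Fin N) ℝ) : ℝ :=
  sInf {x | 0 < x ∧ ∃ i j, P i j = x}

/-- `C = 2 (1 + p^{-N}) / (1 - p^N)`. -/
def constC {N : ℕ} (P : Matrix (Fin N) (Fin N) ℝ) : ℝ :=
  2 * (1 + (minWeight P ^ N)⁻¹) / (1 - minWeight P ^ N)

/-- `q = (1 - p^N)^{1/N}`. -/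
def constQ {N : ℕ} (P : Matrix (Fin N) (Fin N) ℝ) : ℝ :=
  (1 - minWeight P ^ N) ^ (1 / (N : ℝ))

section Algorithm

variable {N a b : ℕ} {X Z W Y Ω : Type*} (Q : Problem N a b X Z W Y) (S : Batches Q Ω)
  (G : Digraph (Fin N)) (P : Matrix (Fin N) (Fin N) ℝ) (α β : ℝ) (τ : ℕ)
  (φ₀ : Vec a) (θ₀ : Fin N → Vec b)

/-- Local head updates of worker `i` in round `k`: the iterates `θ_i(k, s)`, `s = 0, 1, …`, started
at `θ`, with the representation `φ` fixed. -/
def headIterate (i : Fin N) (k : ℕ) (ω : Ω) (φ : Vec a) (θ : Vec b) : ℕ → Vec b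
  | 0 => θ
  | s + 1 =>
    headIterate i k ω φ θ s -
      α • Q.batchGradHead i (S.headBatch i k s ω) φ (headIterate i k ω φ θ s)

/-- The parameters `({φ_i(k)}, {θ_i(k)})` at the start of round `k`. -/
def iterate (ω : Ω) : ℕ → (Fin N → Vec a) × (Fin N → Vec b)
  | 0 => (fun _ => φ₀, θ₀)
  | k + 1 =>
    let φ := (iterate ω k).1
    let θ := (iterate ω k).2
    let θ' : Fin N → Vec b := fun i => headIterate Q S α i k ω (φ i) (θ i) τ
    let φHalf : Fin N → Vec a := fun i =>
      φ i - β • Q.batchGradRep i (S.repBatch i k ω) (φ i) (θ' i)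
    (fun i => ∑ j ∈ neighbors G i, P i j • φHalf j, θ')

/-- `φ_i(k)`. -/
def repAt (k : ℕ) (ω : Ω) (i : Fin N) : Vec a :=
  (iterate Q S G P α β τ φ₀ θ₀ ω k).1 i

/-- `θ_i(k)`. -/
def headAt (k : ℕ) (ω : Ω) (i : Fin N) : Vec b :=
  (iterate Q S G P α β τ φ₀ θ₀ ω k).2 i

/-- The average `\bar φ(k)` of the representations. -/
def meanRep (k : ℕ) (ω : Ω) : Vec a :=
  (1 / (N : ℝ)) • ∑ i, repAt Q S G P α β τ φ₀ θ₀ k ω i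

/-- The convergence measure `M(k)`. -/
def measureM (k : ℕ) (ω : Ω) : ℝ :=
  ‖Q.globalGradRep (meanRep Q S G P α β τ φ₀ θ₀ k ω)
      (headAt Q S G P α β τ φ₀ θ₀ (k + 1) ω)‖ ^ 2
  + α * τ / β * ‖Q.globalGradHead (meanRep Q S G P α β τ φ₀ θ₀ k ω)
      (headAt Q S G P α β τ φ₀ θ₀ k ω)‖ ^ 2
  + (1 / (N : ℝ)) *
      ∑ i, ‖repAt Q S G P α β τ φ₀ θ₀ k ω i - meanRep Q S G P α β τ φ₀ θ₀ k ω‖ ^ 2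

/-- `(1/K) ∑_{k < K} E[M(k)]`. -/
def averageM [MeasurableSpace Ω] (μ : Measure Ω) (K : ℕ) : ℝ :=
  (1 / (K : ℝ)) * ∑ k ∈ Finset.range K, ∫ ω, measureM Q S G P α β τ φ₀ θ₀ k ω ∂μ

end Algorithm

end DePRL

end

/-!
Independence of the mini-batches is used in one form only: an iterate depends on finitely many
mini-batches, so its law is finitely supported, and a fresh mini-batch may be averaged out first.
One round then splits into the head steps and the representation step, and the descent lemma for
functions with Lipschitz gradient applies to each. The resulting decrease of the expected loss at
`\bar φ(k)` is perturbed by the variance of the gradients and by the dispersion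
`(1/N) ∑ ‖φ_i(k) - \bar φ(k)‖²`. Since the consensus matrix of a strongly connected graph contracts
the dispersion by a factor `1 - γ` with `γ = 2 p² / N³`, the dispersion stays of order `β² / γ²`,
which is of order `1 / √(N K)` because `1 / γ²` is at most a multiple of `C / (1 - q)` and `K` is
large. Telescoping the descent inequality gives the rate.
-/

noncomputable section

namespace DePRL

section Determined

variable {Ω ι A B E : Type*} {κ : ι → Type*} {Y : ∀ j, Ω → κ j} {T T' : Finset ι}
  {U : Ω → A} {V : Ω → B}

/-- `U` is a function of the random variables `Y j`, `j ∈ T`. This replaces measurability with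
respect to the σ-algebra they generate, so that no measurable structure on `A` is needed. -/
def DeterminedBy (Y : ∀ j, Ω → κ j) (T : Finset ι) (U : Ω → A) : Prop :=
  ∀ ω ω', (∀ j ∈ T, Y j ω = Y j ω') → U ω = U ω'

namespace DeterminedBy

lemma mono (h : DeterminedBy Y T U) (hT : T ⊆ T') : DeterminedBy Y T' U :=
  fun ω ω' hω => h ω ω' fun j hj => hω j (hT hj)

lemma self {j : ι} (hj : j ∈ T) : DeterminedBy Y T (Y j) := fun _ _ h => h j hj

lemma comp (h : DeterminedBy Y T U) (f : A → B) : DeterminedBy Y T fun ω => f (U ω) :=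
  fun ω ω' hω => congrArg f (h ω ω' hω)

lemma prodMk (hU : DeterminedBy Y T U) (hV : DeterminedBy Y T V) :
    DeterminedBy Y T fun ω => (U ω, V ω) :=
  fun ω ω' hω => Prod.ext (hU ω ω' hω) (hV ω ω' hω)

lemma pi {α : Type*} {A : α → Type*} {U : ∀ i, Ω → A i} (h : ∀ i, DeterminedBy Y T (U i)) :
    DeterminedBy Y T fun ω i => U i ω :=
  fun ω ω' hω => funext fun i => h i ω ω' hω

lemma exists_eq_comp [Nonempty A] (h : DeterminedBy Y T U) :
    ∃ F : (∀ j : T, κ j) → A, U = F ∘ fun ω (j : T) => Y j ω := by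
  have hf : Function.FactorsThrough U (fun ω (j : T) => Y j ω) := fun ω ω' hω =>
    h ω ω' fun j hj => congrFun hω ⟨j, hj⟩
  exact ⟨Function.extend _ U fun _ => Classical.arbitrary A,
    funext fun ω => (hf.extend_apply _ ω).symm⟩

variable [MeasurableSpace Ω] {μ : Measure Ω} [∀ j, Finite (κ j)]

lemma memLp [IsFiniteMeasure μ] [NormedAddCommGroup E] {U : Ω → E} {p : ENNReal}
    (h : DeterminedBy Y T U) (hY : ∀ j, Measurable[_, ⊤] (Y j)) : MemLp U p μ := by
  let _ : ∀ j, MeasurableSpace (κ j) := fun _ => ⊤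
  obtain ⟨F, rfl⟩ := h.exists_eq_comp
  have hYT : Measurable fun ω (j : T) => Y j ω := measurable_pi_lambda _ fun j => hY j
  exact (MemLp.of_discrete (f := F)).comp_of_map hYT.aemeasurable

lemma integrable [IsFiniteMeasure μ] [NormedAddCommGroup E] {U : Ω → E}
    (h : DeterminedBy Y T U) (hY : ∀ j, Measurable[_, ⊤] (Y j)) : Integrable U μ :=
  memLp_one_iff_integrable.1 (h.memLp hY)

/-- A bound for `V` with `U` held at an arbitrary fixed value may be integrated over `U`, since
`U` and `V` depend on disjoint parts of an independent family. -/
lemma integral_comp_le [IsProbabilityMeasure μ] (hU : DeterminedBy Y T U)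
    (hV : DeterminedBy Y T' V) (hT : Disjoint T T') (hY : ∀ j, Measurable[_, ⊤] (Y j))
    (hind : iIndepFun (m := fun _ => ⊤) Y μ) (g : A → B → ℝ) (m : A → ℝ)
    (hm : ∀ u, ∫ ω, g u (V ω) ∂μ ≤ m u) :
    ∫ ω, g (U ω) (V ω) ∂μ ≤ ∫ ω, m (U ω) ∂μ := by
  let _ : ∀ j, MeasurableSpace (κ j) := fun _ => ⊤
  have hΩ : Nonempty Ω := μ.nonempty_of_neZero
  have : Nonempty A := hΩ.map U
  have : Nonempty B := hΩ.map V
  have hmU : Integrable (fun ω => m (U ω)) μ := (hU.comp m).integrable hY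
  obtain ⟨F, rfl⟩ := hU.exists_eq_comp
  obtain ⟨H, rfl⟩ := hV.exists_eq_comp
  set YT := fun ω (j : T) => Y j ω
  set YT' := fun ω (j : T') => Y j ω
  have hYT : Measurable YT := measurable_pi_lambda _ fun j => hY j
  have hYT' : Measurable YT' := measurable_pi_lambda _ fun j => hY j
  have hlaw := (indepFun_iff_map_prod_eq_prod_map_map hYT.aemeasurable hYT'.aemeasurable).1
    (hind.indepFun_finset T T' hT hY)
  have hfinite := Integrable.of_finite (f := fun z => g (F z.1) (H z.2))
    (μ := (μ.map YT).prod (μ.map YT'))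
  have hswap : ∫ ω, g (F (YT ω)) (H (YT' ω)) ∂μ
      = ∫ ω, ∫ ω', g (F (YT ω)) (H (YT' ω')) ∂μ ∂μ := by
    calc ∫ ω, g (F (YT ω)) (H (YT' ω)) ∂μ
        = ∫ z, g (F z.1) (H z.2) ∂(μ.map YT).prod (μ.map YT') := by
          rw [← hlaw, integral_map (hYT.prodMk hYT').aemeasurable (hlaw ▸ hfinite.1)]
      _ = ∫ y, ∫ y', g (F y) (H y') ∂μ.map YT' ∂μ.map YT := integral_prod _ hfinite
      _ = ∫ ω, ∫ ω', g (F (YT ω)) (H (YT' ω')) ∂μ ∂μ := by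
          rw [integral_map hYT.aemeasurable (Integrable.of_finite).1]
          congr 1 with ω
          exact integral_map hYT'.aemeasurable (Integrable.of_finite).1
  simp only [Function.comp_apply] at hm hmU ⊢
  rw [hswap]
  exact integral_mono ((Integrable.of_finite (f := fun y => ∫ ω', g (F y) (H (YT' ω')) ∂μ)
    (μ := μ.map YT)).comp_measurable hYT) hmU fun ω => hm _

lemma indepFun [IsProbabilityMeasure μ] [MeasurableSpace A] [MeasurableSpace B]
    (hU : DeterminedBy Y T U) (hV : DeterminedBy Y T' V) (hT : Disjoint T T')
    (hY : ∀ j, Measurable[_, ⊤] (Y j)) (hind : iIndepFun (m := fun _ => ⊤) Y μ) :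
    IndepFun U V μ := by
  let _ : ∀ j, MeasurableSpace (κ j) := fun _ => ⊤
  have hΩ : Nonempty Ω := μ.nonempty_of_neZero
  have : Nonempty A := hΩ.map U
  have : Nonempty B := hΩ.map V
  obtain ⟨F, rfl⟩ := hU.exists_eq_comp
  obtain ⟨H, rfl⟩ := hV.exists_eq_comp
  exact (hind.indepFun_finset T T' hT hY).comp .of_discrete .of_discrete

end DeterminedBy

end Determined

section Average

variable {ι E : Type*} [Fintype ι] [NormedAddCommGroup E] [NormedSpace ℝ E]

/-- The mean of a finite family of vectors, equal to `0` for the empty family. -/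
def avg (x : ι → E) : E := (1 / (Fintype.card ι : ℝ)) • ∑ i, x i

lemma avg_add (x y : ι → E) : avg (fun i => x i + y i) = avg x + avg y := by
  simp only [avg, Finset.sum_add_distrib, smul_add]

lemma avg_sub (x y : ι → E) : avg (fun i => x i - y i) = avg x - avg y := by
  simp only [avg, Finset.sum_sub_distrib, smul_sub]

lemma avg_smul (c : ℝ) (x : ι → E) : avg (fun i => c • x i) = c • avg x := by
  simp only [avg, ← Finset.smul_sum, smul_comm c]

lemma avg_mul (c : ℝ) (x : ι → ℝ) : avg (fun i => c * x i) = c * avg x := avg_smul c x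

lemma avg_const [Nonempty ι] (v : E) : avg (fun _ : ι => v) = v := by
  have : (Fintype.card ι : ℝ) ≠ 0 := by simp
  rw [avg, Finset.sum_const, Finset.card_univ, ← Nat.cast_smul_eq_nsmul ℝ, smul_smul,
    one_div_mul_cancel this, one_smul]

lemma avg_mono {x y : ι → ℝ} (h : ∀ i, x i ≤ y i) : avg x ≤ avg y := by
  unfold avg
  gcongr with i
  exact h i

lemma avg_nonneg {x : ι → ℝ} (h : ∀ i, 0 ≤ x i) : 0 ≤ avg x :=
  mul_nonneg (by positivity) (Finset.sum_nonneg fun i _ => h i)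

lemma norm_avg_le (x : ι → E) : ‖avg x‖ ≤ avg fun i => ‖x i‖ := by
  rw [avg, norm_smul, Real.norm_of_nonneg (by positivity)]
  exact mul_le_mul_of_nonneg_left (norm_sum_le _ _) (by positivity)

lemma sum_sub_avg (x : ι → E) : ∑ i, (x i - avg x) = 0 := by
  cases isEmpty_or_nonempty ι
  · simp
  have : avg (fun i => x i - avg x) = 0 := by rw [avg_sub, avg_const, sub_self]
  simpa [avg] using this

lemma integral_avg {Ω : Type*} [MeasurableSpace Ω] {μ : Measure Ω} {x : ι → Ω → E}
    (hx : ∀ i, Integrable (x i) μ) : ∫ ω, avg (fun i => x i ω) ∂μ = avg fun i => ∫ ω, x i ω ∂μ := by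
  simp only [avg, integral_smul, integral_finsetSum _ fun i _ => hx i]

end Average

section Dispersion

variable {ι E : Type*} [Fintype ι] [NormedAddCommGroup E] [InnerProductSpace ℝ E]

/-- The mean squared distance of a family of vectors to its mean. -/
def dispersion (x : ι → E) : ℝ := avg fun i => ‖x i - avg x‖ ^ 2

lemma dispersion_nonneg (x : ι → E) : 0 ≤ dispersion x := avg_nonneg fun _ => sq_nonneg _

lemma avg_norm_sub_sq [Nonempty ι] (x : ι → E) (v : E) :
    avg (fun i => ‖x i - v‖ ^ 2) = dispersion x + ‖avg x - v‖ ^ 2 := by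
  have hexpand (i) : ‖x i - v‖ ^ 2 = ‖x i - avg x‖ ^ 2
      + (2 * inner ℝ (x i - avg x) (avg x - v) + ‖avg x - v‖ ^ 2) := by
    rw [← add_assoc, ← norm_add_sq_real, sub_add_sub_cancel]
  have hcross : avg (fun i => inner ℝ (x i - avg x) (avg x - v)) = 0 := by
    rw [avg, ← sum_inner, sum_sub_avg, inner_zero_left, smul_zero]
  simp only [hexpand, avg_add, avg_mul, avg_const, hcross, dispersion]
  ring

lemma dispersion_le [Nonempty ι] (x : ι → E) (v : E) :
    dispersion x ≤ avg fun i => ‖x i - v‖ ^ 2 := by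
  rw [avg_norm_sub_sq]
  exact le_add_of_nonneg_right (sq_nonneg _)

lemma norm_avg_sq_le [Nonempty ι] (x : ι → E) : ‖avg x‖ ^ 2 ≤ avg fun i => ‖x i‖ ^ 2 := by
  have h := avg_norm_sub_sq x 0
  simp only [sub_zero] at h
  rw [h]
  exact le_add_of_nonneg_left (dispersion_nonneg x)

end Dispersion

section Norm

variable {E : Type*} [SeminormedAddCommGroup E]

lemma norm_sum_sq_le {ι : Type*} (s : Finset ι) (x : ι → E) :
    ‖∑ i ∈ s, x i‖ ^ 2 ≤ s.card * ∑ i ∈ s, ‖x i‖ ^ 2 :=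
  (pow_le_pow_left₀ (norm_nonneg _) (norm_sum_le _ _) 2).trans sq_sum_le_card_mul_sum_sq

lemma norm_sub_sq_le_young {η : ℝ} (hη : 0 < η) (x y : E) :
    ‖x - y‖ ^ 2 ≤ (1 + η) * ‖x‖ ^ 2 + (1 + 1 / η) * ‖y‖ ^ 2 := by
  have hsquare : 0 ≤ 1 / η * (η * ‖x‖ - ‖y‖) ^ 2 := by positivity
  calc ‖x - y‖ ^ 2 ≤ (‖x‖ + ‖y‖) ^ 2 := by gcongr; exact norm_sub_le x y
    _ ≤ (‖x‖ + ‖y‖) ^ 2 + 1 / η * (η * ‖x‖ - ‖y‖) ^ 2 := le_add_of_nonneg_right hsquare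
    _ = (1 + η) * ‖x‖ ^ 2 + (1 + 1 / η) * ‖y‖ ^ 2 := by field_simp; ring

lemma norm_sq_map_zero_le {F : Type*} [SeminormedAddCommGroup F] [NormedSpace ℝ E] {L α : ℝ}
    {f : E → F} (hf : ∀ x y, ‖f x - f y‖ ≤ L * ‖x - y‖) {y g : ℕ → E}
    (hy : ∀ s, y (s + 1) = y s - α • g s) (s : ℕ) :
    ‖f (y 0)‖ ^ 2
      ≤ 2 * ‖f (y s)‖ ^ 2 + 2 * L ^ 2 * (α ^ 2 * s) * ∑ r ∈ Finset.range s, ‖g r‖ ^ 2 := by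
  have hsub : y s - y 0 = -(α • ∑ r ∈ Finset.range s, g r) := by
    simp only [← Finset.sum_range_sub, hy, sub_sub_cancel_left, Finset.sum_neg_distrib,
      Finset.smul_sum]
  have hdrift : ‖y s - y 0‖ ^ 2 ≤ α ^ 2 * (s * ∑ r ∈ Finset.range s, ‖g r‖ ^ 2) := by
    rw [hsub, norm_neg, norm_smul, mul_pow, Real.norm_eq_abs, sq_abs]
    gcongr
    simpa using norm_sum_sq_le (Finset.range s) g
  calc ‖f (y 0)‖ ^ 2 = ‖f (y s) - (f (y s) - f (y 0))‖ ^ 2 := by rw [sub_sub_cancel]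
    _ ≤ 2 * ‖f (y s)‖ ^ 2 + 2 * ‖f (y s) - f (y 0)‖ ^ 2 := by
        refine (norm_sub_sq_le_young one_pos _ _).trans_eq ?_
        norm_num
    _ ≤ 2 * ‖f (y s)‖ ^ 2 + 2 * (L * ‖y s - y 0‖) ^ 2 := by gcongr; exact hf _ _
    _ = 2 * ‖f (y s)‖ ^ 2 + 2 * L ^ 2 * ‖y s - y 0‖ ^ 2 := by ring
    _ ≤ 2 * ‖f (y s)‖ ^ 2
        + 2 * L ^ 2 * (α ^ 2 * (s * ∑ r ∈ Finset.range s, ‖g r‖ ^ 2)) := by gcongr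
    _ = _ := by ring

end Norm

section Descent

variable {E : Type*} [NormedAddCommGroup E] [InnerProductSpace ℝ E] [CompleteSpace E] {f : E → ℝ}
  {L : ℝ}

lemma hasDerivAt_comp_add_smul (hf : Differentiable ℝ f) (x d : E) (t : ℝ) :
    HasDerivAt (fun t : ℝ => f (x + t • d)) (inner ℝ (gradient f (x + t • d)) d) t := by
  have hline : HasDerivAt (fun t : ℝ => x + t • d) d t := by
    simpa using ((hasDerivAt_id t).smul_const d).const_add x
  refine ((hf (x + t • d)).hasGradientAt.hasFDerivAt.comp_hasDerivAt t hline).congr_deriv ?_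
  rw [InnerProductSpace.toDual_apply_apply]

lemma le_quadratic_of_lipschitz_gradient (hf : Differentiable ℝ f)
    (hL : ∀ x y, ‖gradient f x - gradient f y‖ ≤ L * ‖x - y‖) (x d : E) :
    f (x + d) ≤ f x + inner ℝ (gradient f x) d + L / 2 * ‖d‖ ^ 2 := by
  set h : ℝ → ℝ := fun t =>
    f (x + t • d) - t * inner ℝ (gradient f x) d - L / 2 * ‖d‖ ^ 2 * t ^ 2 with hdef
  have hderiv (t : ℝ) : HasDerivAt h (inner ℝ (gradient f (x + t • d) - gradient f x) d
      - L * ‖d‖ ^ 2 * t) t := by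
    have hlin := (hasDerivAt_id t).mul_const (inner ℝ (gradient f x) d)
    have hquad := ((hasDerivAt_id t).pow 2).const_mul (L / 2 * ‖d‖ ^ 2)
    refine (((hasDerivAt_comp_add_smul hf x d t).sub hlin).sub hquad).congr_deriv ?_
    simp only [id_eq, inner_sub_left]
    ring
  have hnonpos (t : ℝ) (ht : 0 ≤ t) :
      inner ℝ (gradient f (x + t • d) - gradient f x) d - L * ‖d‖ ^ 2 * t ≤ 0 := by
    have hLip := hL (x + t • d) x
    rw [add_sub_cancel_left, norm_smul, Real.norm_of_nonneg ht] at hLip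
    calc _ ≤ ‖gradient f (x + t • d) - gradient f x‖ * ‖d‖ - L * ‖d‖ ^ 2 * t := by
          gcongr; exact real_inner_le_norm _ _
      _ ≤ L * (t * ‖d‖) * ‖d‖ - L * ‖d‖ ^ 2 * t := by gcongr
      _ = 0 := by ring
  have hanti : AntitoneOn h (Set.Icc 0 1) :=
    antitoneOn_of_deriv_nonpos (convex_Icc 0 1)
      (fun t _ => (hderiv t).continuousAt.continuousWithinAt)
      (fun t _ => (hderiv t).differentiableAt.differentiableWithinAt) fun t ht => by
        rw [(hderiv t).deriv]
        exact hnonpos t (interior_subset ht).1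
  have hle := hanti (Set.left_mem_Icc.2 zero_le_one) (Set.right_mem_Icc.2 zero_le_one) zero_le_one
  simp only [hdef, one_smul, zero_smul, add_zero] at hle
  linarith

end Descent

section SecondMoment

variable {Ω E : Type*} [MeasurableSpace Ω] {μ : Measure Ω} [IsProbabilityMeasure μ]
  [NormedAddCommGroup E] [InnerProductSpace ℝ E] [CompleteSpace E]

lemma integral_norm_sub_sq {g : Ω → E} (hg : MemLp g 2 μ) (c : E) :
    ∫ ω, ‖g ω - c‖ ^ 2 ∂μ
      = ∫ ω, ‖g ω - ∫ ω', g ω' ∂μ‖ ^ 2 ∂μ + ‖∫ ω, g ω ∂μ - c‖ ^ 2 := by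
  set v := ∫ ω, g ω ∂μ with hv
  have hint : Integrable g μ := hg.integrable (by norm_num)
  have hsq : Integrable (fun ω => ‖g ω - v‖ ^ 2) μ :=
    (hg.sub (memLp_const v)).integrable_norm_pow two_ne_zero
  have hcentred : Integrable (fun ω => g ω - v) μ := hint.sub (integrable_const v)
  have hinner : Integrable (fun ω => 2 * inner ℝ (v - c) (g ω - v)) μ :=
    (hcentred.const_inner _).const_mul 2
  have hinner_add : Integrable (fun ω => 2 * inner ℝ (v - c) (g ω - v) + ‖v - c‖ ^ 2) μ :=
    hinner.add (integrable_const _)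
  have hcross : ∫ ω, inner ℝ (v - c) (g ω - v) ∂μ = 0 := by
    rw [integral_inner hcentred, integral_sub hint (integrable_const v)]
    simp [hv]
  have hexpand (ω) : ‖g ω - c‖ ^ 2
      = ‖g ω - v‖ ^ 2 + (2 * inner ℝ (v - c) (g ω - v) + ‖v - c‖ ^ 2) := by
    rw [← sub_add_sub_cancel (g ω) v c, norm_add_sq_real, real_inner_comm, add_assoc]
  simp only [hexpand]
  rw [integral_add hsq hinner_add, integral_add hinner (integrable_const _),
    integral_const_mul, hcross]
  simp

lemma integral_norm_sq {g : Ω → E} (hg : MemLp g 2 μ) :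
    ∫ ω, ‖g ω‖ ^ 2 ∂μ = ∫ ω, ‖g ω - ∫ ω', g ω' ∂μ‖ ^ 2 ∂μ + ‖∫ ω, g ω ∂μ‖ ^ 2 := by
  simpa using integral_norm_sub_sq hg 0

lemma integral_comp_sub_smul_le {f : E → ℝ} {L α s : ℝ} {x v : E} {g : Ω → E}
    (hf : Differentiable ℝ f) (hL : ∀ x y, ‖gradient f x - gradient f y‖ ≤ L * ‖x - y‖)
    (hL0 : 0 ≤ L) (hg : MemLp g 2 μ) (hfg : Integrable (fun ω => f (x - α • g ω)) μ)
    (hv : ∫ ω, g ω ∂μ = v) (hs : ∫ ω, ‖g ω - v‖ ^ 2 ∂μ ≤ s) :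
    ∫ ω, f (x - α • g ω) ∂μ
      ≤ f x - α / 2 * ‖gradient f x‖ ^ 2 - α / 2 * (1 - L * α) * ‖v‖ ^ 2
        + α / 2 * ‖gradient f x - v‖ ^ 2 + L * α ^ 2 / 2 * s := by
  have hlin : Integrable (fun ω => f x - α * inner ℝ (gradient f x) (g ω)) μ :=
    (integrable_const _).sub (((hg.integrable (by norm_num)).const_inner _).const_mul α)
  have hsq : Integrable (fun ω => L * α ^ 2 / 2 * ‖g ω‖ ^ 2) μ :=
    (hg.integrable_norm_pow two_ne_zero).const_mul _
  have hquad : ∫ ω, f (x - α • g ω) ∂μ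
      ≤ f x - α * inner ℝ (gradient f x) v + L * α ^ 2 / 2 * ∫ ω, ‖g ω‖ ^ 2 ∂μ := by
    calc ∫ ω, f (x - α • g ω) ∂μ
        ≤ ∫ ω, (f x - α * inner ℝ (gradient f x) (g ω) + L * α ^ 2 / 2 * ‖g ω‖ ^ 2) ∂μ := by
          refine integral_mono hfg (hlin.add hsq) fun ω => ?_
          have h := le_quadratic_of_lipschitz_gradient hf hL x (-(α • g ω))
          rw [← sub_eq_add_neg, inner_neg_right, real_inner_smul_right, norm_neg, norm_smul,
            mul_pow, Real.norm_eq_abs, sq_abs] at h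
          linarith
      _ = _ := by
          rw [integral_add hlin hsq, integral_sub (integrable_const _)
            (((hg.integrable (by norm_num)).const_inner _).const_mul α), integral_const_mul,
            integral_const_mul, integral_inner (hg.integrable (by norm_num)), hv]
          simp
  rw [integral_norm_sq hg, hv] at hquad
  have hpolar := norm_sub_sq_real (gradient f x) v
  have hvar : L * α ^ 2 / 2 * ∫ ω, ‖g ω - v‖ ^ 2 ∂μ ≤ L * α ^ 2 / 2 * s := by gcongr
  linear_combination hquad + hvar - α / 2 * hpolar

lemma integral_norm_avg_sub_sq {ι : Type*} [Fintype ι] [MeasurableSpace E] [BorelSpace E]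
    {g : ι → Ω → E} (hg : ∀ i, MemLp (g i) 2 μ)
    (hind : Pairwise fun i j => IndepFun (g i) (g j) μ) :
    ∫ ω, ‖avg (fun i => g i ω) - avg (fun i => ∫ ω', g i ω' ∂μ)‖ ^ 2 ∂μ
      = 1 / (Fintype.card ι : ℝ) * avg fun i => ∫ ω, ‖g i ω - ∫ ω', g i ω' ∂μ‖ ^ 2 ∂μ := by
  classical
  set ξ : ι → Ω → E := fun i ω => g i ω - ∫ ω', g i ω' ∂μ with hξ
  have hLp (i) : MemLp (ξ i) 2 μ := (hg i).sub (memLp_const _)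
  have hzero (i) : ∫ ω, ξ i ω ∂μ = 0 := by
    rw [integral_sub ((hg i).integrable (by norm_num)) (integrable_const _)]
    simp
  have horth (i j) : ∫ ω, inner ℝ (ξ i ω) (ξ j ω) ∂μ
      = if i = j then ∫ ω, ‖ξ i ω‖ ^ 2 ∂μ else 0 := by
    split_ifs with h
    · subst h
      simp only [real_inner_self_eq_norm_sq]
    · have hij : IndepFun (ξ i) (ξ j) μ :=
        (hind h).comp (measurable_id.sub_const _) (measurable_id.sub_const _)
      calc _ = inner ℝ (∫ ω, ξ i ω ∂μ) (∫ ω, ξ j ω ∂μ) :=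
            hij.integral_bilin ((hLp i).integrable (by norm_num))
              ((hLp j).integrable (by norm_num)) (innerSL ℝ)
        _ = 0 := by rw [hzero, inner_zero_left]
  have hint (i j) : Integrable (fun ω => inner ℝ (ξ i ω) (ξ j ω)) μ :=
    ((hLp i).norm.integrable_mul (hLp j).norm).mono' ((hLp i).1.inner (hLp j).1)
      (.of_forall fun ω => norm_inner_le_norm _ _)
  have hexpand (ω) : ‖avg (fun i => g i ω) - avg (fun i => ∫ ω', g i ω' ∂μ)‖ ^ 2
      = (1 / (Fintype.card ι : ℝ)) ^ 2 * ∑ i, ∑ j, inner ℝ (ξ i ω) (ξ j ω) := by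
    rw [← avg_sub, avg, norm_smul, mul_pow, Real.norm_of_nonneg (by positivity),
      ← real_inner_self_eq_norm_sq, sum_inner]
    simp only [inner_sum, hξ]
  simp only [hexpand]
  rw [integral_const_mul,
    integral_finsetSum _ fun i _ => integrable_finsetSum _ fun j _ => hint i j]
  simp only [integral_finsetSum _ fun j _ => hint _ j, horth, Finset.sum_ite_eq, Finset.mem_univ,
    if_true, avg, smul_eq_mul]
  ring

end SecondMoment

section Mixing

variable {ι : Type*} [Fintype ι]

lemma dist_le_of_reflTransGen {M : Type*} [PseudoMetricSpace M] {r : ι → ι → Prop} (x : ι → M)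
    {m : ℝ} (hm : 0 ≤ m) (hr : ∀ i j, r i j → dist (x i) (x j) ≤ m) {i j : ι}
    (h : Relation.ReflTransGen r i j) : dist (x i) (x j) ≤ Fintype.card ι * m := by
  classical
  let H := SimpleGraph.fromRel r
  have hreach : H.Reachable i j := by
    induction h with
    | refl => rfl
    | @tail k l _ hkl ih =>
      rcases eq_or_ne k l with rfl | hne
      · exact ih
      · exact ih.trans (SimpleGraph.Adj.reachable (G := H) ⟨hne, Or.inl hkl⟩)
  have hadj {i j} (h : H.Adj i j) : dist (x i) (x j) ≤ m := by
    rcases h with ⟨-, h | h⟩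
    · exact hr i j h
    · exact dist_comm (x i) (x j) ▸ hr j i h
  have hwalk {i j} (w : H.Walk i j) : dist (x i) (x j) ≤ w.length * m := by
    induction w with
    | nil => simp
    | @cons u v z huv w ih =>
      rw [SimpleGraph.Walk.length_cons, Nat.cast_succ]
      linarith [dist_triangle (x u) (x v) (x z), hadj huv]
  obtain ⟨w⟩ := hreach
  refine (hwalk w.toPath.1).trans ?_
  gcongr
  exact w.toPath.2.length_lt.le

lemma two_mul_le_sum_sum_of_symm {F : ι → ι → ℝ} (hF : ∀ a b, 0 ≤ F a b)
    (hsymm : ∀ a b, F a b = F b a) {i j : ι} (hij : i ≠ j) : 2 * F i j ≤ ∑ a, ∑ b, F a b := by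
  classical
  calc 2 * F i j = ∑ z ∈ {(i, j), (j, i)}, F z.1 z.2 := by
        rw [Finset.sum_pair (by simp [hij]), hsymm j i, two_mul]
    _ ≤ ∑ z : ι × ι, F z.1 z.2 :=
        Finset.sum_le_sum_of_subset_of_nonneg (Finset.subset_univ _) fun z _ _ => hF z.1 z.2
    _ = ∑ a, ∑ b, F a b := Fintype.sum_prod_type _

lemma two_mul_sq_mul_norm_sub_sq_le {E : Type*} [SeminormedAddCommGroup E] {w : ι → ℝ} {p : ℝ}
    (hw : ∀ j, 0 ≤ w j) (hp : 0 ≤ p) {i j : ι} (hi : p ≤ w i) (hj : p ≤ w j) (x : ι → E) :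
    2 * (p ^ 2 * ‖x i - x j‖ ^ 2) ≤ ∑ a, ∑ b, w a * w b * ‖x a - x b‖ ^ 2 := by
  have hnonneg (a b) : 0 ≤ w a * w b * ‖x a - x b‖ ^ 2 :=
    mul_nonneg (mul_nonneg (hw a) (hw b)) (sq_nonneg _)
  rcases eq_or_ne i j with rfl | hij
  · simpa using Finset.sum_nonneg fun a _ => Finset.sum_nonneg fun b _ => hnonneg a b
  calc 2 * (p ^ 2 * ‖x i - x j‖ ^ 2) ≤ 2 * (w i * w j * ‖x i - x j‖ ^ 2) := by
        rw [sq p]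
        gcongr
        exact hw i
    _ ≤ ∑ a, ∑ b, w a * w b * ‖x a - x b‖ ^ 2 :=
        two_mul_le_sum_sum_of_symm hnonneg
          (fun a b => by rw [mul_comm (w a), norm_sub_rev]) hij

variable {E : Type*} [NormedAddCommGroup E] [InnerProductSpace ℝ E]

lemma norm_sum_smul_sq {w : ι → ℝ} (hw : ∑ j, w j = 1) (x : ι → E) :
    ‖∑ j, w j • x j‖ ^ 2 = ∑ j, w j * ‖x j‖ ^ 2
      - 1 / 2 * ∑ j, ∑ l, w j * w l * ‖x j - x l‖ ^ 2 := by
  have hinner : ‖∑ j, w j • x j‖ ^ 2 = ∑ j, ∑ l, w j * w l * inner ℝ (x j) (x l) := by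
    simp only [← real_inner_self_eq_norm_sq, sum_inner, inner_sum, real_inner_smul_left,
      real_inner_smul_right]
    congr! 2 with j _ l _
    rw [real_inner_comm]
    ring
  have hfst : ∑ j, ∑ l, w j * w l * ‖x j‖ ^ 2 = ∑ j, w j * ‖x j‖ ^ 2 := by
    simp only [← Finset.sum_mul, ← Finset.mul_sum, hw, mul_one]
  have hsnd : ∑ j, ∑ l, w j * w l * ‖x l‖ ^ 2 = ∑ j, w j * ‖x j‖ ^ 2 := by
    rw [Finset.sum_comm]
    simp only [← Finset.sum_mul, hw, one_mul]
  have hexpand : ∑ j, ∑ l, w j * w l * ‖x j - x l‖ ^ 2 = ∑ j, ∑ l, w j * w l * ‖x j‖ ^ 2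
      - 2 * ∑ j, ∑ l, w j * w l * inner ℝ (x j) (x l) + ∑ j, ∑ l, w j * w l * ‖x l‖ ^ 2 := by
    simp only [Finset.mul_sum, ← Finset.sum_sub_distrib, ← Finset.sum_add_distrib,
      norm_sub_sq_real]
    congr! 2 with j _ l _
    ring
  rw [hexpand, hfst, hsnd, hinner]
  ring

lemma avg_avg_norm_sub_sq [Nonempty ι] (x : ι → E) :
    avg (fun i => avg fun j => ‖x j - x i‖ ^ 2) = 2 * dispersion x := by
  have hcentre : avg (fun i => ‖avg x - x i‖ ^ 2) = dispersion x := by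
    simp only [norm_sub_rev (avg x), dispersion]
  simp only [avg_norm_sub_sq, avg_add, avg_const, hcentre, two_mul]

lemma two_mul_dispersion_le_of_dist_le [Nonempty ι] {x : ι → E} {d : ℝ}
    (hx : ∀ i j, dist (x i) (x j) ≤ d) : 2 * dispersion x ≤ d ^ 2 := by
  have hpair (i j) : ‖x j - x i‖ ^ 2 ≤ d ^ 2 := by
    rw [← dist_eq_norm]
    exact pow_le_pow_left₀ dist_nonneg (hx j i) 2
  rw [← avg_avg_norm_sub_sq]
  refine (avg_mono fun i => avg_mono fun j => hpair i j).trans_eq ?_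
  rw [avg_const, avg_const]

lemma dispersion_sub_smul_le {η : ℝ} (hη : 0 < η) (x g : ι → E) (β : ℝ) :
    dispersion (fun i => x i - β • g i)
      ≤ (1 + η) * dispersion x + (1 + 1 / η) * (β ^ 2 * dispersion g) := by
  have hcentre (i) : x i - β • g i - avg (fun i => x i - β • g i)
      = (x i - avg x) - β • (g i - avg g) := by
    rw [avg_sub, avg_smul, smul_sub]
    abel
  have hnorm (i) : ‖β • (g i - avg g)‖ ^ 2 = β ^ 2 * ‖g i - avg g‖ ^ 2 := by
    rw [norm_smul, mul_pow, Real.norm_eq_abs, sq_abs]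
  simp only [dispersion, hcentre]
  refine (avg_mono fun i => norm_sub_sq_le_young hη _ _).trans_eq ?_
  simp only [hnorm, avg_add, avg_mul]

variable [DecidableEq ι] {P : Matrix ι ι ℝ}

lemma avg_mix (hP : P ∈ doublyStochastic ℝ ι) (x : ι → E) :
    avg (fun i => ∑ j, P i j • x j) = avg x := by
  simp only [avg]
  rw [Finset.sum_comm]
  simp only [← Finset.sum_smul, (mem_doublyStochastic_iff_sum.1 hP).2.2, one_smul]

lemma dispersion_mix [Nonempty ι] (hP : P ∈ doublyStochastic ℝ ι) (x : ι → E) :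
    dispersion (fun i => ∑ j, P i j • x j) = dispersion x
      - 1 / 2 * avg fun i => ∑ j, ∑ l, P i j * P i l * ‖x j - x l‖ ^ 2 := by
  have hdisp (y : ι → E) : dispersion y = avg (fun i => ‖y i‖ ^ 2) - ‖avg y‖ ^ 2 := by
    simpa using (sub_eq_of_eq_add (avg_norm_sub_sq y 0)).symm
  have hsq : avg (fun i => ∑ j, P i j * ‖x j‖ ^ 2) = avg fun j => ‖x j‖ ^ 2 :=
    avg_mix hP fun j => ‖x j‖ ^ 2
  rw [hdisp, hdisp, avg_mix hP]
  simp only [norm_sum_smul_sq ((mem_doublyStochastic_iff_sum.1 hP).2.1 _), avg_sub, avg_mul, hsq]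
  ring

lemma dispersion_mix_le [Nonempty ι] (hP : P ∈ doublyStochastic ℝ ι) {r : ι → ι → Prop} {p : ℝ}
    (hp : 0 < p) (hdiag : ∀ i, p ≤ P i i) (hr : ∀ i j, r i j → p ≤ P j i)
    (hconn : ∀ i j, Relation.ReflTransGen r i j) (x : ι → E) :
    dispersion (fun i => ∑ j, P i j • x j)
      ≤ (1 - 2 * p ^ 2 / (Fintype.card ι : ℝ) ^ 3) * dispersion x := by
  set n : ℝ := (Fintype.card ι : ℝ) with hn
  have : 0 < n := by simp [hn, Fintype.card_pos]
  have hP0 := (mem_doublyStochastic_iff_sum.1 hP).1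
  set localDrop : ι → ℝ := fun i => ∑ j, ∑ l, P i j * P i l * ‖x j - x l‖ ^ 2
  have hlocal (i) : 0 ≤ localDrop i :=
    Finset.sum_nonneg fun j _ => Finset.sum_nonneg fun l _ =>
      mul_nonneg (mul_nonneg (hP0 i j) (hP0 i l)) (sq_nonneg _)
  set drop := 1 / 2 * avg localDrop with hdrop
  have hdrop0 : 0 ≤ drop := mul_nonneg (by norm_num) (avg_nonneg hlocal)
  have hlocal_le (i) : localDrop i ≤ 2 * (n * drop) := by
    refine (Finset.single_le_sum (fun i _ => hlocal i) (Finset.mem_univ i)).trans_eq ?_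
    rw [hdrop, avg, smul_eq_mul, hn]
    field_simp
  have hedge (i j) (h : r i j) : dist (x i) (x j) ≤ √(n * drop) / p := by
    rw [dist_eq_norm, le_div_iff₀ hp]
    refine Real.le_sqrt_of_sq_le ?_
    linarith [two_mul_sq_mul_norm_sub_sq_le (hP0 j) hp.le (hr i j h) (hdiag j) x, hlocal_le j]
  have htwo : 2 * dispersion x ≤ n ^ 3 * drop / p ^ 2 := by
    refine (two_mul_dispersion_le_of_dist_le fun i j =>
      dist_le_of_reflTransGen x (by positivity) hedge (hconn i j)).trans_eq ?_
    rw [mul_pow, div_pow, Real.sq_sqrt (by positivity)]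
    ring
  have hlower : 2 * p ^ 2 / n ^ 3 * dispersion x ≤ drop := by
    rw [div_mul_eq_mul_div, div_le_iff₀ (by positivity)]
    rw [le_div_iff₀ (by positivity)] at htwo
    linarith
  rw [dispersion_mix hP]
  linarith

end Mixing

section ConsensusMatrix

variable {N : ℕ} {G : Digraph (Fin N)} {P : Matrix (Fin N) (Fin N) ℝ}

lemma finite_pos_entries (P : Matrix (Fin N) (Fin N) ℝ) :
    {x | 0 < x ∧ ∃ i j, P i j = x}.Finite := by
  refine (Set.finite_range fun z : Fin N × Fin N => P z.1 z.2).subset ?_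
  rintro x ⟨-, i, j, rfl⟩
  exact ⟨(i, j), rfl⟩

lemma minWeight_le {i j : Fin N} (h : 0 < P i j) : minWeight P ≤ P i j :=
  csInf_le (finite_pos_entries P).bddBelow ⟨h, i, j, rfl⟩

lemma cube_le_four_mul_two_pow (n : ℕ) : n ^ 3 ≤ 4 * 2 ^ n := by
  rcases lt_or_ge n 4 with h | h
  · interval_cases n <;> norm_num
  induction n, h using Nat.le_induction with
  | base => norm_num
  | succ n hn ih =>
    rw [pow_succ 2]
    nlinarith [Nat.mul_le_mul hn hn, Nat.mul_le_mul hn (Nat.mul_le_mul hn hn)]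

/-- A contraction factor `1 - gap P` for the dispersion under mixing with `P`: if `m` is the largest
distance between values across an edge, mixing lowers the dispersion by at least `p² m² / N`, and
the dispersion is at most `(N m)² / 2`. -/
def gap (P : Matrix (Fin N) (Fin N) ℝ) : ℝ := 2 * minWeight P ^ 2 / (N : ℝ) ^ 3

namespace IsConsensusMatrix

lemma pos_of_adj (hP : IsConsensusMatrix G P) {i j : Fin N} (h : G.Adj i j) : 0 < P j i := by
  rw [hP.pos_iff]
  simp [neighbors, h]

lemma diag_pos (hP : IsConsensusMatrix G P) (i : Fin N) : 0 < P i i := by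
  rw [hP.pos_iff]
  simp [neighbors]

lemma sum_neighbors {E : Type*} [AddCommGroup E] [Module ℝ E] (hP : IsConsensusMatrix G P)
    (i : Fin N) (x : Fin N → E) : ∑ j ∈ neighbors G i, P i j • x j = ∑ j, P i j • x j := by
  refine Finset.sum_subset (Finset.subset_univ _) fun j _ hj => ?_
  rw [← hP.pos_iff, not_lt] at hj
  rw [le_antisymm hj ((mem_doublyStochastic_iff_sum.1 hP.doublyStochastic).1 i j), zero_smul]

lemma minWeight_pos [NeZero N] (hP : IsConsensusMatrix G P) : 0 < minWeight P := by
  have hne : Set.Nonempty {x | 0 < x ∧ ∃ i j, P i j = x} := ⟨_, hP.diag_pos 0, _, _, rfl⟩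
  exact (hne.csInf_mem (finite_pos_entries P)).1

lemma gap_pos [NeZero N] (hP : IsConsensusMatrix G P) : 0 < gap P := by
  have := hP.minWeight_pos
  have : (0 : ℝ) < N := by exact_mod_cast NeZero.pos N
  unfold gap
  positivity

lemma minWeight_le_half (hP : IsConsensusMatrix G P) (hN : 2 ≤ N) (hG : StronglyConnected G) :
    minWeight P ≤ 1 / 2 := by
  have : Nontrivial (Fin N) := Fin.nontrivial_iff_two_le.2 hN
  obtain ⟨i, j, hij, hadj⟩ : ∃ i j, i ≠ j ∧ G.Adj i j := by
    by_contra! hcon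
    obtain ⟨i, j, hij⟩ := exists_pair_ne (Fin N)
    refine hij ?_
    clear hij
    induction hG i j with
    | refl => rfl
    | tail _ hkl ih => exact ih.trans (not_imp_comm.1 (hcon _ _) (not_not.2 hkl))
  have hrow : P j i + P j j ≤ 1 := by
    rw [← (mem_doublyStochastic_iff_sum.1 hP.doublyStochastic).2.1 j, ← Finset.sum_pair hij]
    exact Finset.sum_le_sum_of_subset_of_nonneg (Finset.subset_univ _)
      fun l _ _ => (mem_doublyStochastic_iff_sum.1 hP.doublyStochastic).1 j l
  linarith [minWeight_le (hP.pos_of_adj hadj), minWeight_le (hP.diag_pos j)]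

lemma gap_le (hP : IsConsensusMatrix G P) (hN : 2 ≤ N) (hG : StronglyConnected G) :
    gap P ≤ 1 / 16 := by
  have : NeZero N := ⟨by omega⟩
  have hp := hP.minWeight_pos
  have hN' : (2 : ℝ) ≤ N := by exact_mod_cast hN
  calc gap P ≤ 2 * (1 / 2) ^ 2 / 2 ^ 3 := by
        unfold gap
        gcongr
        exact hP.minWeight_le_half hN hG
    _ = 1 / 16 := by norm_num

lemma minWeight_pow_le_gap (hP : IsConsensusMatrix G P) (hN : 2 ≤ N) (hG : StronglyConnected G) :
    minWeight P ^ N ≤ 8 * gap P := by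
  have : NeZero N := ⟨by omega⟩
  have hp := hP.minWeight_pos
  have : (0 : ℝ) < N := by exact_mod_cast NeZero.pos N
  obtain ⟨n, hn⟩ : ∃ n, N = n + 2 := ⟨N - 2, by omega⟩
  have hcube : (N : ℝ) ^ 3 ≤ 16 * 2 ^ n := by
    have h : (N : ℝ) ^ 3 ≤ 4 * 2 ^ N := by exact_mod_cast cube_le_four_mul_two_pow N
    rw [hn, pow_add] at h
    linarith [hn ▸ h]
  have hhalf : minWeight P ^ n ≤ (1 / 2) ^ n := by
    gcongr
    exact hP.minWeight_le_half hN hG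
  have hprod : minWeight P ^ n * (N : ℝ) ^ 3 ≤ 16 := by
    calc minWeight P ^ n * (N : ℝ) ^ 3 ≤ (1 / 2) ^ n * (16 * 2 ^ n) := by gcongr
      _ = 16 * (1 / 2 * 2) ^ n := by rw [mul_pow]; ring
      _ = 16 := by norm_num
  calc minWeight P ^ N = minWeight P ^ n * minWeight P ^ 2 := by rw [← pow_add, ← hn]
    _ ≤ 16 / (N : ℝ) ^ 3 * minWeight P ^ 2 := by
        gcongr
        rwa [le_div_iff₀ (by positivity)]
    _ = 8 * gap P := by unfold gap; ring

lemma minWeight_pow_lt_one (hP : IsConsensusMatrix G P) (hN : 2 ≤ N) (hG : StronglyConnected G) :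
    minWeight P ^ N < 1 := by
  linarith [hP.minWeight_pow_le_gap hN hG, hP.gap_le hN hG]

lemma constQ_lt_one (hP : IsConsensusMatrix G P) (hN : 2 ≤ N) (hG : StronglyConnected G) :
    constQ P < 1 := by
  have : NeZero N := ⟨by omega⟩
  have h0 := pow_pos hP.minWeight_pos N
  have h1 := hP.minWeight_pow_lt_one hN hG
  have : (0 : ℝ) < N := by exact_mod_cast NeZero.pos N
  exact Real.rpow_lt_one (by linarith) (by linarith) (by positivity)

lemma one_sub_le_constQ (hP : IsConsensusMatrix G P) (hN : 2 ≤ N) (hG : StronglyConnected G) :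
    1 - minWeight P ^ N ≤ constQ P := by
  have : NeZero N := ⟨by omega⟩
  have h0 := pow_pos hP.minWeight_pos N
  have h1 := hP.minWeight_pow_lt_one hN hG
  have hN' : (1 : ℝ) ≤ N := by exact_mod_cast NeZero.one_le
  refine Real.self_le_rpow_of_le_one (by linarith) (by linarith) ?_
  exact (div_le_one (by linarith)).2 hN'

lemma two_mul_inv_le_constC (hP : IsConsensusMatrix G P) (hN : 2 ≤ N)
    (hG : StronglyConnected G) : 2 * (minWeight P ^ N)⁻¹ ≤ constC P := by
  have : NeZero N := ⟨by omega⟩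
  have h0 := pow_pos hP.minWeight_pos N
  have h1 := hP.minWeight_pow_lt_one hN hG
  have hinv := inv_pos.2 h0
  rw [constC, le_div_iff₀ (by linarith)]
  nlinarith

lemma constC_pos (hP : IsConsensusMatrix G P) (hN : 2 ≤ N) (hG : StronglyConnected G) :
    0 < constC P := by
  have : NeZero N := ⟨by omega⟩
  have := pow_pos hP.minWeight_pos N
  exact lt_of_lt_of_le (by positivity) (hP.two_mul_inv_le_constC hN hG)

lemma one_div_gap_sq_le (hP : IsConsensusMatrix G P) (hN : 2 ≤ N) (hG : StronglyConnected G) :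
    1 / gap P ^ 2 ≤ 32 * (constC P / (1 - constQ P)) := by
  have : NeZero N := ⟨by omega⟩
  have h0 := pow_pos hP.minWeight_pos N
  have hC := hP.two_mul_inv_le_constC hN hG
  have hq := hP.one_sub_le_constQ hN hG
  have hq' := hP.constQ_lt_one hN hG
  calc 1 / gap P ^ 2 ≤ 1 / (minWeight P ^ N / 8) ^ 2 := by
        gcongr
        linarith [hP.minWeight_pow_le_gap hN hG]
    _ = 32 * (2 * (minWeight P ^ N)⁻¹ / minWeight P ^ N) := by field_simp; norm_num
    _ ≤ 32 * (constC P / (1 - constQ P)) := by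
        gcongr
        · exact (hP.constC_pos hN hG).le
        · linarith

variable {E : Type*} [NormedAddCommGroup E] [InnerProductSpace ℝ E]

lemma dispersion_mix_le (hP : IsConsensusMatrix G P) [NeZero N] (hG : StronglyConnected G)
    (x : Fin N → E) : dispersion (fun i => ∑ j, P i j • x j) ≤ (1 - gap P) * dispersion x := by
  simpa [gap] using DePRL.dispersion_mix_le hP.doublyStochastic hP.minWeight_pos
    (fun i => minWeight_le (hP.diag_pos i)) (fun i j h => minWeight_le (hP.pos_of_adj h)) hG x

lemma dispersion_step_le (hP : IsConsensusMatrix G P) (hN : 2 ≤ N) (hG : StronglyConnected G)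
    (x g : Fin N → E) (β : ℝ) :
    dispersion (fun i => ∑ j ∈ neighbors G i, P i j • (x j - β • g j))
      ≤ (1 - gap P / 2) * dispersion x + 2 / gap P * (β ^ 2 * dispersion g) := by
  have : NeZero N := ⟨by omega⟩
  have hγ := hP.gap_pos
  have hγ1 := hP.gap_le hN hG
  have hx := dispersion_nonneg x
  have hg := mul_nonneg (sq_nonneg β) (dispersion_nonneg g)
  have hxcoef : (1 - gap P) * (1 + gap P / 2) ≤ 1 - gap P / 2 := by nlinarith
  have hgcoef : (1 - gap P) * (1 + 1 / (gap P / 2)) ≤ 2 / gap P := by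
    have : (1 - gap P) * (1 + 1 / (gap P / 2)) = 2 / gap P - 1 - gap P := by field_simp; ring
    linarith
  simp only [hP.sum_neighbors]
  calc dispersion (fun i => ∑ j, P i j • (x j - β • g j))
      ≤ (1 - gap P) * dispersion (fun j => x j - β • g j) := hP.dispersion_mix_le hG _
    _ ≤ (1 - gap P) * ((1 + gap P / 2) * dispersion x
          + (1 + 1 / (gap P / 2)) * (β ^ 2 * dispersion g)) := by
        gcongr
        · linarith
        · exact dispersion_sub_smul_le (by positivity) x g β
    _ = (1 - gap P) * (1 + gap P / 2) * dispersion x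
          + (1 - gap P) * (1 + 1 / (gap P / 2)) * (β ^ 2 * dispersion g) := by ring
    _ ≤ (1 - gap P / 2) * dispersion x + 2 / gap P * (β ^ 2 * dispersion g) := by gcongr

lemma avg_step (hP : IsConsensusMatrix G P) (x g : Fin N → E) (β : ℝ) :
    avg (fun i => ∑ j ∈ neighbors G i, P i j • (x j - β • g j)) = avg x - β • avg g := by
  simp only [hP.sum_neighbors, avg_mix hP.doublyStochastic, avg_sub, avg_smul]

end IsConsensusMatrix

end ConsensusMatrix

section Losses

variable {N a b : ℕ} {X Z W Y : Type*} {Q : Problem N a b X Z W Y} {L : ℝ}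

namespace Problem

lemma globalLoss_eq_avg (φ : Vec a) (θ : Fin N → Vec b) :
    Q.globalLoss φ θ = avg fun i => Q.localLoss i φ (θ i) := by
  rw [avg, Fintype.card_fin, globalLoss, smul_eq_mul]

lemma globalGradRep_eq_avg (φ : Vec a) (θ : Fin N → Vec b) :
    Q.globalGradRep φ θ = avg fun i => Q.gradRep i φ (θ i) := by
  rw [avg, Fintype.card_fin, globalGradRep]

lemma norm_globalGradHead_sq_le [NeZero N] (φ : Vec a) (θ : Fin N → Vec b) :
    ‖Q.globalGradHead φ θ‖ ^ 2 ≤ avg fun i => ‖Q.gradHead i φ (θ i)‖ ^ 2 := by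
  simpa [avg, globalGradHead] using norm_avg_sq_le fun i => Q.gradHead i φ (θ i)

namespace PartiallyDifferentiable

lemma localLoss_rep (hQ : Q.PartiallyDifferentiable) (i : Fin N) (θ : Vec b) :
    Differentiable ℝ fun φ => Q.localLoss i φ θ :=
  (Differentiable.fun_sum fun m _ => hQ.1 i m θ).const_mul _

lemma localLoss_head (hQ : Q.PartiallyDifferentiable) (i : Fin N) (φ : Vec a) :
    Differentiable ℝ fun θ => Q.localLoss i φ θ :=
  (Differentiable.fun_sum fun m _ => hQ.2 i m φ).const_mul _

lemma globalLoss_rep (hQ : Q.PartiallyDifferentiable) (θ : Fin N → Vec b) :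
    Differentiable ℝ fun φ => Q.globalLoss φ θ :=
  (Differentiable.fun_sum fun i _ => hQ.localLoss_rep i (θ i)).const_mul _

lemma gradient_globalLoss (hQ : Q.PartiallyDifferentiable) (φ : Vec a) (θ : Fin N → Vec b) :
    gradient (fun φ' => Q.globalLoss φ' θ) φ = Q.globalGradRep φ θ := by
  refine HasGradientAt.gradient (hasGradientAt_iff_hasFDerivAt.2 ?_)
  have hsum : HasFDerivAt (fun φ' => ∑ i, Q.localLoss i φ' (θ i))
      (∑ i, InnerProductSpace.toDual ℝ (Vec a) (Q.gradRep i φ (θ i))) φ :=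
    HasFDerivAt.fun_sum fun i _ => (hQ.localLoss_rep i (θ i) φ).hasGradientAt.hasFDerivAt
  refine (hsum.const_mul (1 / (N : ℝ))).congr_fderiv ?_
  simp [globalGradRep, map_sum]

end PartiallyDifferentiable

namespace LipschitzGradients

lemma gradRep_rep (hL : Q.LipschitzGradients L) (i : Fin N) (φ φ' : Vec a) (θ : Vec b) :
    ‖Q.gradRep i φ θ - Q.gradRep i φ' θ‖ ≤ L * ‖φ - φ'‖ := by
  simpa using hL.1 i φ φ' θ θ

lemma gradHead_rep (hL : Q.LipschitzGradients L) (i : Fin N) (φ φ' : Vec a) (θ : Vec b) :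
    ‖Q.gradHead i φ θ - Q.gradHead i φ' θ‖ ≤ L * ‖φ - φ'‖ := by
  simpa using hL.2 i φ φ' θ θ

lemma gradHead_head (hL : Q.LipschitzGradients L) (i : Fin N) (φ : Vec a) (θ θ' : Vec b) :
    ‖Q.gradHead i φ θ - Q.gradHead i φ θ'‖ ≤ L * ‖θ - θ'‖ := by
  simpa using hL.2 i φ φ θ θ'

lemma globalGradRep_rep (hL : Q.LipschitzGradients L) [NeZero N] (φ φ' : Vec a)
    (θ : Fin N → Vec b) :
    ‖Q.globalGradRep φ θ - Q.globalGradRep φ' θ‖ ≤ L * ‖φ - φ'‖ := by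
  rw [globalGradRep_eq_avg, globalGradRep_eq_avg, ← avg_sub]
  calc ‖avg fun i => Q.gradRep i φ (θ i) - Q.gradRep i φ' (θ i)‖
      ≤ avg fun i => ‖Q.gradRep i φ (θ i) - Q.gradRep i φ' (θ i)‖ := norm_avg_le _
    _ ≤ avg fun _ : Fin N => L * ‖φ - φ'‖ := avg_mono fun i => hL.gradRep_rep i φ φ' (θ i)
    _ = L * ‖φ - φ'‖ := avg_const _

lemma avg_norm_gradRep_sub_sq_le (hL : Q.LipschitzGradients L) (φ : Fin N → Vec a)
    (θ : Fin N → Vec b) :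
    avg (fun i => ‖Q.gradRep i (φ i) (θ i) - Q.gradRep i (avg φ) (θ i)‖ ^ 2)
      ≤ L ^ 2 * dispersion φ := by
  rw [dispersion, ← avg_mul]
  refine avg_mono fun i => ?_
  rw [← mul_pow]
  gcongr
  exact hL.gradRep_rep i (φ i) (avg φ) (θ i)

lemma norm_globalGradRep_sub_sq_le (hL : Q.LipschitzGradients L) [NeZero N] (φ : Fin N → Vec a)
    (θ : Fin N → Vec b) :
    ‖Q.globalGradRep (avg φ) θ - avg (fun i => Q.gradRep i (φ i) (θ i))‖ ^ 2
      ≤ L ^ 2 * dispersion φ := by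
  rw [norm_sub_rev, globalGradRep_eq_avg, ← avg_sub]
  exact (norm_avg_sq_le _).trans (hL.avg_norm_gradRep_sub_sq_le φ θ)

lemma avg_norm_gradRep_sub_globalGradRep_sq_le (hL : Q.LipschitzGradients L) {ς : ℝ}
    (hς : Q.BoundedVariability ς) (φ : Fin N → Vec a) (θ : Fin N → Vec b) :
    avg (fun i => ‖Q.gradRep i (φ i) (θ i) - Q.globalGradRep (avg φ) θ‖ ^ 2)
      ≤ 2 * (ς ^ 2 + L ^ 2 * dispersion φ) := by
  have hvar : avg (fun i => ‖Q.gradRep i (avg φ) (θ i) - Q.globalGradRep (avg φ) θ‖ ^ 2)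
      ≤ ς ^ 2 := by
    simpa [avg] using hς (avg φ) θ
  have hsplit (i) : ‖Q.gradRep i (φ i) (θ i) - Q.globalGradRep (avg φ) θ‖ ^ 2
      ≤ 2 * (‖Q.gradRep i (avg φ) (θ i) - Q.globalGradRep (avg φ) θ‖ ^ 2
        + ‖Q.gradRep i (φ i) (θ i) - Q.gradRep i (avg φ) (θ i)‖ ^ 2) := by
    rw [← sub_add_sub_cancel' (Q.gradRep i (avg φ) (θ i))]
    refine (pow_le_pow_left₀ (norm_nonneg _) (norm_add_le _ _) 2).trans add_sq_le
  refine (avg_mono hsplit).trans ?_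
  rw [avg_mul, avg_add]
  linarith [hL.avg_norm_gradRep_sub_sq_le φ θ]

end LipschitzGradients

end Problem

end Losses

section Past

variable {N τ k s : ℕ}

/-- The mini-batches drawn before the local head step `s` of round `k`. -/
def past (N τ k s : ℕ) : Finset (Fin N × ℕ × Option (Fin τ)) :=
  open Classical in
  (Finset.univ ×ˢ Finset.range (k + 1) ×ˢ Finset.univ).filter fun j =>
    j.2.1 < k ∨ ∃ t : Fin τ, j.2.2 = some t ∧ t.1 < s

lemma mem_past {j : Fin N × ℕ × Option (Fin τ)} :
    j ∈ past N τ k s ↔ j.2.1 < k ∨ j.2.1 = k ∧ ∃ t : Fin τ, j.2.2 = some t ∧ t.1 < s := by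
  simp only [past, Finset.mem_filter, Finset.mem_product, Finset.mem_univ, Finset.mem_range,
    true_and, and_true, Nat.lt_succ_iff_lt_or_eq]
  have : j.2.1 < k → j.2.1 ≠ k := ne_of_lt
  tauto

lemma past_mono {s' : ℕ} (h : s ≤ s') : past N τ k s ⊆ past N τ k s' := by
  intro j
  simp only [mem_past]
  rintro (hk | ⟨hk, t, ht, hs⟩)
  · exact Or.inl hk
  · exact Or.inr ⟨hk, t, ht, hs.trans_le h⟩

lemma past_subset_succ : past N τ k s ⊆ past N τ (k + 1) 0 := by
  intro j
  simp only [mem_past]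
  omega

lemma head_mem_past (i : Fin N) (hs : s < τ) : (i, k, some ⟨s, hs⟩) ∈ past N τ k (s + 1) := by
  simp [mem_past]

lemma disjoint_past_head (i : Fin N) (hs : s < τ) :
    Disjoint (past N τ k s) {(i, k, some ⟨s, hs⟩)} := by
  simp [mem_past]

/-- The mini-batches of the representation step of round `k`. -/
def repIndices (N τ k : ℕ) : Finset (Fin N × ℕ × Option (Fin τ)) :=
  Finset.univ ×ˢ {(k, none)}

lemma mem_repIndices (i : Fin N) : (i, k, none) ∈ repIndices N τ k := by
  simp [repIndices]

lemma repIndices_subset_past : repIndices N τ k ⊆ past N τ (k + 1) 0 := by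
  rintro ⟨i, k', o⟩ hj
  obtain ⟨rfl, rfl⟩ : k = k' ∧ none = o := by simpa [repIndices, eq_comm] using hj
  simp [mem_past]

lemma disjoint_past_repIndices : Disjoint (past N τ k s) (repIndices N τ k) := by
  refine Finset.disjoint_left.2 fun j => ?_
  simp only [mem_past, repIndices, Finset.mem_product, Finset.mem_singleton]
  rintro (hk | ⟨-, t, ht, -⟩) ⟨-, hj⟩
  · simp [hj] at hk
  · simp [hj] at ht

end Past

section HeadRound

lemma le_of_descent_of_drift {l U V : ℕ → ℝ} {α L c v : ℝ} {τ : ℕ} (hα : 0 ≤ α)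
    (hLα : (L * (α * τ)) ^ 2 ≤ 1 / 4) (hV : ∀ s, 0 ≤ V s)
    (hstep : ∀ s < τ, l (s + 1) ≤ l s - α / 2 * U s - α / 4 * V s + c)
    (hdrift : ∀ s < τ, U 0 ≤ 2 * U s
      + 2 * L ^ 2 * (α ^ 2 * τ) * (∑ r ∈ Finset.range τ, V r + τ * v)) :
    l τ ≤ l 0 - α * τ / 4 * U 0 + τ * c + α ^ 3 * τ ^ 3 * L ^ 2 / 2 * v := by
  set SU := ∑ s ∈ Finset.range τ, U s
  set SV := ∑ s ∈ Finset.range τ, V s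
  have htelescope : l τ - l 0 ≤ -(α / 2 * SU) - α / 4 * SV + τ * c := by
    rw [← Finset.sum_range_sub]
    calc ∑ s ∈ Finset.range τ, (l (s + 1) - l s)
        ≤ ∑ s ∈ Finset.range τ, (-(α / 2 * U s) - α / 4 * V s + c) :=
          Finset.sum_le_sum fun s hs => by linarith [hstep s (Finset.mem_range.1 hs)]
      _ = -(α / 2 * SU) - α / 4 * SV + τ * c := by
          simp [Finset.sum_add_distrib, Finset.sum_sub_distrib, ← Finset.mul_sum, SU, SV]
  have hsum : τ * U 0 ≤ 2 * SU + τ * (2 * L ^ 2 * (α ^ 2 * τ) * (SV + τ * v)) := by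
    calc τ * U 0 = ∑ _s ∈ Finset.range τ, U 0 := by simp
      _ ≤ ∑ s ∈ Finset.range τ, (2 * U s + 2 * L ^ 2 * (α ^ 2 * τ) * (SV + τ * v)) :=
          Finset.sum_le_sum fun s hs => hdrift s (Finset.mem_range.1 hs)
      _ = 2 * SU + τ * (2 * L ^ 2 * (α ^ 2 * τ) * (SV + τ * v)) := by
          rw [Finset.sum_add_distrib, ← Finset.mul_sum, Finset.sum_const, Finset.card_range,
            nsmul_eq_mul]
  have hSV : 0 ≤ α * SV := mul_nonneg hα (Finset.sum_nonneg fun s _ => hV s)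
  have hαsum := mul_le_mul_of_nonneg_left hsum (by positivity : 0 ≤ α / 4)
  have habsorb := mul_le_mul_of_nonneg_right hLα hSV
  linarith

variable {N a b : ℕ} {X Z W Y Ω : Type*} {Q : Problem N a b X Z W Y} {S : Batches Q Ω}
  {τ s : ℕ} {L σ α : ℝ}

lemma determinedBy_headBatch (i : Fin N) (k : ℕ) (hs : s < τ) :
    DeterminedBy (S.family τ) {(i, k, some ⟨s, hs⟩)} (S.headBatch i k s) :=
  DeterminedBy.self (Y := S.family τ) (Finset.mem_singleton_self _)

lemma DeterminedBy.batchGradHead {i : Fin N} {k : ℕ} (hs : s < τ) {φ : Ω → Vec a}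
    {θ : Ω → Vec b} (hφ : DeterminedBy (S.family τ) (past N τ k s) φ)
    (hθ : DeterminedBy (S.family τ) (past N τ k s) θ) :
    DeterminedBy (S.family τ) (past N τ k (s + 1))
      fun ω => Q.batchGradHead i (S.headBatch i k s ω) (φ ω) (θ ω) :=
  have hB := (determinedBy_headBatch (S := S) i k hs).mono
    (Finset.singleton_subset_iff.2 (head_mem_past i hs))
  (hB.prodMk ((hφ.prodMk hθ).mono (past_mono s.le_succ))).comp
    fun z => Q.batchGradHead i z.1 z.2.1 z.2.2

lemma DeterminedBy.headIterate {i : Fin N} {k : ℕ} {φ : Ω → Vec a} {θ : Ω → Vec b}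
    (hφ : DeterminedBy (S.family τ) (past N τ k 0) φ)
    (hθ : DeterminedBy (S.family τ) (past N τ k 0) θ) (hs : s ≤ τ) :
    DeterminedBy (S.family τ) (past N τ k s) fun ω => headIterate Q S α i k ω (φ ω) (θ ω) s := by
  induction s with
  | zero => exact hθ
  | succ s ih =>
    have hy := ih (by omega)
    have hg := (hφ.mono (past_mono s.zero_le)).batchGradHead (i := i) (by omega : s < τ) hy
    exact ((hy.mono (past_mono s.le_succ)).prodMk hg).comp fun z => z.1 - α • z.2

variable [MeasurableSpace Ω] {μ : Measure Ω} [IsProbabilityMeasure μ]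

lemma integral_localLoss_sub_smul_batchGradHead_le (hL0 : 0 ≤ L) (hα : 0 ≤ α)
    (hQ : Q.PartiallyDifferentiable) (hL : Q.LipschitzGradients L)
    (hS : S.IsIndependentSampling μ τ) (hU : S.Unbiased μ τ) (hV : S.BoundedVariance μ τ σ)
    (i : Fin N) (k : ℕ) (hs : s < τ) (φ x : Vec a) (θ : Vec b) :
    ∫ ω, Q.localLoss i x (θ - α • Q.batchGradHead i (S.headBatch i k s ω) φ θ) ∂μ
      ≤ Q.localLoss i x θ - α / 2 * ‖Q.gradHead i x θ‖ ^ 2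
        - α / 2 * (1 - L * α) * ‖Q.gradHead i φ θ‖ ^ 2
        + (α * L ^ 2 / 2 * ‖φ - x‖ ^ 2 + L * α ^ 2 / 2 * σ ^ 2) := by
  have hB : DeterminedBy (S.family τ) _ (S.headBatch i k s) := determinedBy_headBatch i k hs
  have hstep := integral_comp_sub_smul_le (α := α) (hQ.localLoss_head i x) (hL.gradHead_head i x)
    hL0 ((hB.comp fun B => Q.batchGradHead i B φ θ).memLp hS.measurable)
    ((hB.comp fun B => Q.localLoss i x (θ - α • Q.batchGradHead i B φ θ)).integrable
      hS.measurable) (hU.2 i k s hs φ θ) (hV.2 i k s hs φ θ)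
  have hbias : ‖Q.gradHead i x θ - Q.gradHead i φ θ‖ ^ 2 ≤ L ^ 2 * ‖φ - x‖ ^ 2 := by
    rw [← mul_pow, norm_sub_rev φ]
    gcongr
    exact hL.gradHead_rep i x φ θ
  have hαbias := mul_le_mul_of_nonneg_left hbias (by positivity : 0 ≤ α / 2)
  simp only [Problem.gradHead] at hstep hαbias ⊢
  linarith

lemma integral_norm_batchGradHead_sq_le (hS : S.IsIndependentSampling μ τ) (hU : S.Unbiased μ τ)
    (hV : S.BoundedVariance μ τ σ) (i : Fin N) (k : ℕ) (hs : s < τ) (φ : Vec a) (θ : Vec b) :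
    ∫ ω, ‖Q.batchGradHead i (S.headBatch i k s ω) φ θ‖ ^ 2 ∂μ
      ≤ ‖Q.gradHead i φ θ‖ ^ 2 + σ ^ 2 := by
  rw [integral_norm_sq (((determinedBy_headBatch i k hs).comp
    fun B => Q.batchGradHead i B φ θ).memLp hS.measurable), hU.2 i k s hs φ θ]
  linarith [hV.2 i k s hs φ θ]

variable {i : Fin N} {k : ℕ} {φ x : Ω → Vec a} {θ : Ω → Vec b}

lemma integral_localLoss_head_step_le (hL0 : 0 ≤ L) (hα : 0 ≤ α)
    (hQ : Q.PartiallyDifferentiable) (hL : Q.LipschitzGradients L)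
    (hS : S.IsIndependentSampling μ τ) (hU : S.Unbiased μ τ) (hV : S.BoundedVariance μ τ σ)
    (hφ : DeterminedBy (S.family τ) (past N τ k s) φ)
    (hx : DeterminedBy (S.family τ) (past N τ k s) x)
    (hθ : DeterminedBy (S.family τ) (past N τ k s) θ) (hs : s < τ) :
    ∫ ω, Q.localLoss i (x ω)
        (θ ω - α • Q.batchGradHead i (S.headBatch i k s ω) (φ ω) (θ ω)) ∂μ
      ≤ ∫ ω, Q.localLoss i (x ω) (θ ω) ∂μ - α / 2 * ∫ ω, ‖Q.gradHead i (x ω) (θ ω)‖ ^ 2 ∂μ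
        - α / 2 * (1 - L * α) * ∫ ω, ‖Q.gradHead i (φ ω) (θ ω)‖ ^ 2 ∂μ
        + (α * L ^ 2 / 2 * ∫ ω, ‖φ ω - x ω‖ ^ 2 ∂μ + L * α ^ 2 / 2 * σ ^ 2) := by
  have hz := hφ.prodMk (hx.prodMk hθ)
  have hloss := (hz.comp fun z => Q.localLoss i z.2.1 z.2.2).integrable (μ := μ) hS.measurable
  have hgradx := (hz.comp fun z => ‖Q.gradHead i z.2.1 z.2.2‖ ^ 2).integrable (μ := μ)
    hS.measurable
  have hgradφ := (hz.comp fun z => ‖Q.gradHead i z.1 z.2.2‖ ^ 2).integrable (μ := μ)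
    hS.measurable
  have hdist := (hz.comp fun z => ‖z.1 - z.2.1‖ ^ 2).integrable (μ := μ) hS.measurable
  refine (hz.integral_comp_le (determinedBy_headBatch i k hs) (disjoint_past_head i hs)
    hS.measurable hS.indep
    (fun z B => Q.localLoss i z.2.1 (z.2.2 - α • Q.batchGradHead i B z.1 z.2.2)) _
    fun z => integral_localLoss_sub_smul_batchGradHead_le hL0 hα hQ hL hS hU hV i k hs
      z.1 z.2.1 z.2.2).trans_eq ?_
  simp (disch := fun_prop) only [integral_add, integral_sub, integral_const_mul, integral_const,
    probReal_univ, one_smul]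

lemma integral_norm_batchGradHead_comp_sq_le (hS : S.IsIndependentSampling μ τ)
    (hU : S.Unbiased μ τ) (hV : S.BoundedVariance μ τ σ)
    (hφ : DeterminedBy (S.family τ) (past N τ k s) φ)
    (hθ : DeterminedBy (S.family τ) (past N τ k s) θ) (hs : s < τ) :
    ∫ ω, ‖Q.batchGradHead i (S.headBatch i k s ω) (φ ω) (θ ω)‖ ^ 2 ∂μ
      ≤ ∫ ω, ‖Q.gradHead i (φ ω) (θ ω)‖ ^ 2 ∂μ + σ ^ 2 := by
  have hz := hφ.prodMk hθ
  have hgrad := (hz.comp fun z => ‖Q.gradHead i z.1 z.2‖ ^ 2).integrable (μ := μ) hS.measurable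
  refine (hz.integral_comp_le (determinedBy_headBatch i k hs) (disjoint_past_head i hs)
    hS.measurable hS.indep (fun z B => ‖Q.batchGradHead i B z.1 z.2‖ ^ 2) _
    fun z => integral_norm_batchGradHead_sq_le hS hU hV i k hs z.1 z.2).trans_eq ?_
  rw [integral_add hgrad (integrable_const _), integral_const, probReal_univ, one_smul]

lemma integral_norm_gradHead_zero_sq_le (hL : Q.LipschitzGradients L)
    (hS : S.IsIndependentSampling μ τ) (hU : S.Unbiased μ τ) (hV : S.BoundedVariance μ τ σ)
    (hφ : DeterminedBy (S.family τ) (past N τ k 0) φ)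
    (hx : DeterminedBy (S.family τ) (past N τ k 0) x) {y : ℕ → Ω → Vec b}
    (hy : ∀ s ≤ τ, DeterminedBy (S.family τ) (past N τ k s) (y s))
    (hy_succ : ∀ s ω, y (s + 1) ω
      = y s ω - α • Q.batchGradHead i (S.headBatch i k s ω) (φ ω) (y s ω)) (hs : s ≤ τ) :
    ∫ ω, ‖Q.gradHead i (x ω) (y 0 ω)‖ ^ 2 ∂μ
      ≤ 2 * ∫ ω, ‖Q.gradHead i (x ω) (y s ω)‖ ^ 2 ∂μ + 2 * L ^ 2 * (α ^ 2 * τ)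
        * (∑ r ∈ Finset.range τ, ∫ ω, ‖Q.gradHead i (φ ω) (y r ω)‖ ^ 2 ∂μ + τ * σ ^ 2) := by
  set g : ℕ → Ω → Vec b := fun r ω => Q.batchGradHead i (S.headBatch i k r ω) (φ ω) (y r ω)
  have hpoint (ω) : ‖Q.gradHead i (x ω) (y 0 ω)‖ ^ 2 ≤ 2 * ‖Q.gradHead i (x ω) (y s ω)‖ ^ 2
      + 2 * L ^ 2 * (α ^ 2 * τ) * ∑ r ∈ Finset.range τ, ‖g r ω‖ ^ 2 := by
    have hdrift := norm_sq_map_zero_le (f := Q.gradHead i (x ω)) (y := fun r => y r ω)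
      (hL.gradHead_head i (x ω)) (fun r => hy_succ r ω) s
    refine hdrift.trans ?_
    gcongr
  have hgrad (r) (hr : r ≤ τ) : Integrable (fun ω => ‖Q.gradHead i (x ω) (y r ω)‖ ^ 2) μ :=
    (((hx.mono (past_mono r.zero_le)).prodMk (hy r hr)).comp
      fun z => ‖Q.gradHead i z.1 z.2‖ ^ 2).integrable hS.measurable
  have hg (r) (hr : r ∈ Finset.range τ) : Integrable (fun ω => ‖g r ω‖ ^ 2) μ := by
    rw [Finset.mem_range] at hr
    exact (((hφ.mono (past_mono r.zero_le)).batchGradHead hr (hy r hr.le)).comp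
      fun v => ‖v‖ ^ 2).integrable hS.measurable
  have hmoment (r) (hr : r ∈ Finset.range τ) :
      ∫ ω, ‖g r ω‖ ^ 2 ∂μ ≤ ∫ ω, ‖Q.gradHead i (φ ω) (y r ω)‖ ^ 2 ∂μ + σ ^ 2 := by
    rw [Finset.mem_range] at hr
    exact integral_norm_batchGradHead_comp_sq_le hS hU hV (hφ.mono (past_mono r.zero_le))
      (hy r hr.le) hr
  calc ∫ ω, ‖Q.gradHead i (x ω) (y 0 ω)‖ ^ 2 ∂μ
      ≤ ∫ ω, (2 * ‖Q.gradHead i (x ω) (y s ω)‖ ^ 2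
          + 2 * L ^ 2 * (α ^ 2 * τ) * ∑ r ∈ Finset.range τ, ‖g r ω‖ ^ 2) ∂μ :=
        integral_mono (hgrad 0 τ.zero_le) (((hgrad s hs).const_mul _).add
          ((integrable_finsetSum _ hg).const_mul _)) hpoint
    _ = 2 * ∫ ω, ‖Q.gradHead i (x ω) (y s ω)‖ ^ 2 ∂μ
          + 2 * L ^ 2 * (α ^ 2 * τ) * ∑ r ∈ Finset.range τ, ∫ ω, ‖g r ω‖ ^ 2 ∂μ := by
        rw [integral_add ((hgrad s hs).const_mul _) ((integrable_finsetSum _ hg).const_mul _),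
          integral_const_mul, integral_const_mul, integral_finsetSum _ hg]
    _ ≤ 2 * ∫ ω, ‖Q.gradHead i (x ω) (y s ω)‖ ^ 2 ∂μ + 2 * L ^ 2 * (α ^ 2 * τ)
          * ∑ r ∈ Finset.range τ, (∫ ω, ‖Q.gradHead i (φ ω) (y r ω)‖ ^ 2 ∂μ + σ ^ 2) := by
        gcongr with r hr
        exact hmoment r hr
    _ = _ := by
        rw [Finset.sum_add_distrib, Finset.sum_const, Finset.card_range, nsmul_eq_mul]

lemma integral_localLoss_headIterate_le (hL0 : 0 ≤ L) (hα : 0 ≤ α) (hτ : 1 ≤ τ)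
    (hατ : L * (α * τ) ≤ 1 / 2) (hQ : Q.PartiallyDifferentiable) (hL : Q.LipschitzGradients L)
    (hS : S.IsIndependentSampling μ τ) (hU : S.Unbiased μ τ) (hV : S.BoundedVariance μ τ σ)
    (i : Fin N) (k : ℕ) (hφ : DeterminedBy (S.family τ) (past N τ k 0) φ)
    (hx : DeterminedBy (S.family τ) (past N τ k 0) x)
    (hθ : DeterminedBy (S.family τ) (past N τ k 0) θ) :
    ∫ ω, Q.localLoss i (x ω) (headIterate Q S α i k ω (φ ω) (θ ω) τ) ∂μ
      ≤ ∫ ω, Q.localLoss i (x ω) (θ ω) ∂μ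
        - α * τ / 4 * ∫ ω, ‖Q.gradHead i (x ω) (θ ω)‖ ^ 2 ∂μ
        + α * τ * L ^ 2 / 2 * ∫ ω, ‖φ ω - x ω‖ ^ 2 ∂μ
        + (L * α ^ 2 * τ / 2 + α ^ 3 * τ ^ 3 * L ^ 2 / 2) * σ ^ 2 := by
  set y : ℕ → Ω → Vec b := fun s ω => headIterate Q S α i k ω (φ ω) (θ ω) s
  have hy (s) (hs : s ≤ τ) : DeterminedBy (S.family τ) (past N τ k s) (y s) :=
    hφ.headIterate hθ hs
  have hLα : L * α ≤ 1 / 2 := by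
    refine le_trans ?_ hατ
    gcongr
    exact le_mul_of_one_le_right hα (by exact_mod_cast hτ)
  have hsmall : (L * (α * τ)) ^ 2 ≤ 1 / 4 := by
    refine (pow_le_pow_left₀ (by positivity) hατ 2).trans_eq (by norm_num)
  have hstep (s) (hs : s < τ) : ∫ ω, Q.localLoss i (x ω) (y (s + 1) ω) ∂μ
      ≤ ∫ ω, Q.localLoss i (x ω) (y s ω) ∂μ
        - α / 2 * ∫ ω, ‖Q.gradHead i (x ω) (y s ω)‖ ^ 2 ∂μ
        - α / 4 * ∫ ω, ‖Q.gradHead i (φ ω) (y s ω)‖ ^ 2 ∂μ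
        + (α * L ^ 2 / 2 * ∫ ω, ‖φ ω - x ω‖ ^ 2 ∂μ + L * α ^ 2 / 2 * σ ^ 2) := by
    refine (integral_localLoss_head_step_le hL0 hα hQ hL hS hU hV
      (hφ.mono (past_mono s.zero_le)) (hx.mono (past_mono s.zero_le)) (hy s hs.le) hs).trans ?_
    have hcoef : α / 4 ≤ α / 2 * (1 - L * α) := by nlinarith
    have : 0 ≤ ∫ ω, ‖Q.gradHead i (φ ω) (y s ω)‖ ^ 2 ∂μ :=
      integral_nonneg fun ω => sq_nonneg _
    gcongr
  refine (le_of_descent_of_drift (l := fun s => ∫ ω, Q.localLoss i (x ω) (y s ω) ∂μ)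
    (U := fun s => ∫ ω, ‖Q.gradHead i (x ω) (y s ω)‖ ^ 2 ∂μ)
    (V := fun s => ∫ ω, ‖Q.gradHead i (φ ω) (y s ω)‖ ^ 2 ∂μ) hα hsmall
    (fun s => integral_nonneg fun ω => sq_nonneg _) hstep fun s hs =>
    integral_norm_gradHead_zero_sq_le hL hS hU hV hφ hx hy (fun _ _ => rfl) hs.le).trans_eq ?_
  simp only [y, DePRL.headIterate]
  ring

end HeadRound

section RepStep

variable {N a b : ℕ} {X Z W Y Ω : Type*} {Q : Problem N a b X Z W Y} {S : Batches Q Ω} {τ : ℕ}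
  {L σ ς β : ℝ}

lemma determinedBy_repBatch (i : Fin N) (k : ℕ) :
    DeterminedBy (S.family τ) {(i, k, none)} (S.repBatch i k) :=
  DeterminedBy.self (Y := S.family τ) (Finset.mem_singleton_self _)

lemma determinedBy_repBatches (k : ℕ) :
    DeterminedBy (S.family τ) (repIndices N τ k) fun ω i => S.repBatch i k ω :=
  DeterminedBy.pi fun i => (determinedBy_repBatch i k).mono
    (Finset.singleton_subset_iff.2 (mem_repIndices i))

lemma disjoint_repIndex {i j : Fin N} (hij : i ≠ j) (k : ℕ) :
    Disjoint ({(i, k, none)} : Finset (Fin N × ℕ × Option (Fin τ))) {(j, k, none)} := by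
  simpa using hij

variable [MeasurableSpace Ω] {μ : Measure Ω} [IsProbabilityMeasure μ]

lemma memLp_batchGradRep (hS : S.IsIndependentSampling μ τ) (i : Fin N) (k : ℕ) (φ : Vec a)
    (θ : Vec b) : MemLp (fun ω => Q.batchGradRep i (S.repBatch i k ω) φ θ) 2 μ :=
  ((determinedBy_repBatch i k).comp fun B => Q.batchGradRep i B φ θ).memLp hS.measurable

lemma integral_avg_batchGradRep (hS : S.IsIndependentSampling μ τ) (hU : S.Unbiased μ τ) (k : ℕ)
    (φ : Fin N → Vec a) (θ : Fin N → Vec b) :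
    ∫ ω, avg (fun i => Q.batchGradRep i (S.repBatch i k ω) (φ i) (θ i)) ∂μ
      = avg fun i => Q.gradRep i (φ i) (θ i) := by
  rw [integral_avg fun i => (memLp_batchGradRep hS i k (φ i) (θ i)).integrable (by norm_num)]
  simp only [hU.1]

lemma integral_norm_avg_batchGradRep_sub_sq_le [NeZero N] (hS : S.IsIndependentSampling μ τ)
    (hU : S.Unbiased μ τ) (hV : S.BoundedVariance μ τ σ) (k : ℕ) (φ : Fin N → Vec a)
    (θ : Fin N → Vec b) :
    ∫ ω, ‖avg (fun i => Q.batchGradRep i (S.repBatch i k ω) (φ i) (θ i))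
        - avg (fun i => Q.gradRep i (φ i) (θ i))‖ ^ 2 ∂μ ≤ σ ^ 2 / N := by
  have hind : Pairwise fun i j => IndepFun
      (fun ω => Q.batchGradRep i (S.repBatch i k ω) (φ i) (θ i))
      (fun ω => Q.batchGradRep j (S.repBatch j k ω) (φ j) (θ j)) μ := fun i j hij =>
    ((determinedBy_repBatch i k).comp fun B => Q.batchGradRep i B (φ i) (θ i)).indepFun
      ((determinedBy_repBatch j k).comp fun B => Q.batchGradRep j B (φ j) (θ j))
      (disjoint_repIndex hij k) hS.measurable hS.indep
  have hvar := integral_norm_avg_sub_sq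
    (fun i => memLp_batchGradRep hS i k (φ i) (θ i)) hind
  simp only [hU.1, Fintype.card_fin] at hvar
  calc _ = 1 / (N : ℝ) * avg fun i =>
          ∫ ω, ‖Q.batchGradRep i (S.repBatch i k ω) (φ i) (θ i)
            - Q.gradRep i (φ i) (θ i)‖ ^ 2 ∂μ := hvar
    _ ≤ 1 / (N : ℝ) * avg fun _ : Fin N => σ ^ 2 := by
        gcongr
        exact avg_mono fun i => hV.1 i k (φ i) (θ i)
    _ = σ ^ 2 / N := by rw [avg_const, one_div_mul_eq_div]

lemma integral_globalLoss_sub_smul_avg_batchGradRep_le [NeZero N] (hL0 : 0 ≤ L) (hβ : 0 ≤ β)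
    (hLβ : L * β ≤ 1) (hQ : Q.PartiallyDifferentiable) (hL : Q.LipschitzGradients L)
    (hS : S.IsIndependentSampling μ τ) (hU : S.Unbiased μ τ) (hV : S.BoundedVariance μ τ σ)
    (k : ℕ) (φ : Fin N → Vec a) (θ : Fin N → Vec b) :
    ∫ ω, Q.globalLoss (avg φ
        - β • avg fun i => Q.batchGradRep i (S.repBatch i k ω) (φ i) (θ i)) θ ∂μ
      ≤ Q.globalLoss (avg φ) θ - β / 2 * ‖Q.globalGradRep (avg φ) θ‖ ^ 2
        + (β * L ^ 2 / 2 * dispersion φ + L * β ^ 2 * σ ^ 2 / (2 * N)) := by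
  have hB : DeterminedBy (S.family τ) _ fun ω i => S.repBatch i k ω := determinedBy_repBatches k
  have hstep := integral_comp_sub_smul_le (α := β) (x := avg φ) (hQ.globalLoss_rep θ)
    (fun x y => by simpa only [hQ.gradient_globalLoss] using hL.globalGradRep_rep x y θ) hL0
    ((hB.comp fun B => avg fun i => Q.batchGradRep i (B i) (φ i) (θ i)).memLp hS.measurable)
    ((hB.comp fun B => Q.globalLoss
      (avg φ - β • avg fun i => Q.batchGradRep i (B i) (φ i) (θ i)) θ).integrable hS.measurable)
    (integral_avg_batchGradRep hS hU k φ θ)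
    (integral_norm_avg_batchGradRep_sub_sq_le hS hU hV k φ θ)
  rw [hQ.gradient_globalLoss] at hstep
  have hbias := mul_le_mul_of_nonneg_left (hL.norm_globalGradRep_sub_sq_le φ θ)
    (by positivity : 0 ≤ β / 2)
  have hslack : 0 ≤ β / 2 * (1 - L * β) * ‖avg fun i => Q.gradRep i (φ i) (θ i)‖ ^ 2 := by
    have := sub_nonneg.2 hLβ
    positivity
  have hnoise : L * β ^ 2 / 2 * (σ ^ 2 / N) = L * β ^ 2 * σ ^ 2 / (2 * N) := by ring
  linarith

lemma avg_integral_norm_batchGradRep_sub_sq_le [NeZero N] (hL : Q.LipschitzGradients L)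
    (hS : S.IsIndependentSampling μ τ) (hU : S.Unbiased μ τ) (hV : S.BoundedVariance μ τ σ)
    (hς : Q.BoundedVariability ς) (k : ℕ) (φ : Fin N → Vec a) (θ : Fin N → Vec b) :
    avg (fun i => ∫ ω, ‖Q.batchGradRep i (S.repBatch i k ω) (φ i) (θ i)
        - Q.globalGradRep (avg φ) θ‖ ^ 2 ∂μ)
      ≤ σ ^ 2 + 2 * (ς ^ 2 + L ^ 2 * dispersion φ) := by
  have hsplit (i) : ∫ ω, ‖Q.batchGradRep i (S.repBatch i k ω) (φ i) (θ i)
      - Q.globalGradRep (avg φ) θ‖ ^ 2 ∂μ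
      ≤ σ ^ 2 + ‖Q.gradRep i (φ i) (θ i) - Q.globalGradRep (avg φ) θ‖ ^ 2 := by
    rw [integral_norm_sub_sq (memLp_batchGradRep hS i k (φ i) (θ i)), hU.1]
    gcongr
    exact hV.1 i k (φ i) (θ i)
  calc _ ≤ avg fun i => σ ^ 2 + ‖Q.gradRep i (φ i) (θ i) - Q.globalGradRep (avg φ) θ‖ ^ 2 :=
        avg_mono hsplit
    _ ≤ σ ^ 2 + 2 * (ς ^ 2 + L ^ 2 * dispersion φ) := by
        rw [avg_add, avg_const]
        gcongr
        exact hL.avg_norm_gradRep_sub_globalGradRep_sq_le hς φ θ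

lemma integral_dispersion_batchGradRep_le [NeZero N] (hL : Q.LipschitzGradients L)
    (hS : S.IsIndependentSampling μ τ) (hU : S.Unbiased μ τ) (hV : S.BoundedVariance μ τ σ)
    (hς : Q.BoundedVariability ς) (k : ℕ) (φ : Fin N → Vec a) (θ : Fin N → Vec b) :
    ∫ ω, dispersion (fun i => Q.batchGradRep i (S.repBatch i k ω) (φ i) (θ i)) ∂μ
      ≤ σ ^ 2 + 2 * (ς ^ 2 + L ^ 2 * dispersion φ) := by
  have hB : DeterminedBy (S.family τ) _ fun ω i => S.repBatch i k ω := determinedBy_repBatches k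
  set v := Q.globalGradRep (avg φ) θ
  calc ∫ ω, dispersion (fun i => Q.batchGradRep i (S.repBatch i k ω) (φ i) (θ i)) ∂μ
      ≤ ∫ ω, avg (fun i => ‖Q.batchGradRep i (S.repBatch i k ω) (φ i) (θ i) - v‖ ^ 2) ∂μ :=
        integral_mono
          ((hB.comp fun B => dispersion fun i => Q.batchGradRep i (B i) (φ i) (θ i)).integrable
            hS.measurable)
          ((hB.comp fun B => avg fun i =>
            ‖Q.batchGradRep i (B i) (φ i) (θ i) - v‖ ^ 2).integrable hS.measurable)
          fun ω => dispersion_le _ v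
    _ = avg fun i => ∫ ω, ‖Q.batchGradRep i (S.repBatch i k ω) (φ i) (θ i) - v‖ ^ 2 ∂μ :=
        integral_avg fun i => (((memLp_batchGradRep hS i k (φ i) (θ i)).sub
          (memLp_const v)).integrable_norm_pow two_ne_zero)
    _ ≤ σ ^ 2 + 2 * (ς ^ 2 + L ^ 2 * dispersion φ) :=
        avg_integral_norm_batchGradRep_sub_sq_le hL hS hU hV hς k φ θ

variable {k : ℕ} {φ : Ω → Fin N → Vec a} {θ : Ω → Fin N → Vec b}

lemma integral_globalLoss_rep_step_le [NeZero N] (hL0 : 0 ≤ L) (hβ : 0 ≤ β)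
    (hLβ : L * β ≤ 1) (hQ : Q.PartiallyDifferentiable) (hL : Q.LipschitzGradients L)
    (hS : S.IsIndependentSampling μ τ) (hU : S.Unbiased μ τ) (hV : S.BoundedVariance μ τ σ)
    (hφ : DeterminedBy (S.family τ) (past N τ k τ) φ)
    (hθ : DeterminedBy (S.family τ) (past N τ k τ) θ) :
    ∫ ω, Q.globalLoss (avg (φ ω)
        - β • avg fun i => Q.batchGradRep i (S.repBatch i k ω) (φ ω i) (θ ω i)) (θ ω) ∂μ
      ≤ ∫ ω, Q.globalLoss (avg (φ ω)) (θ ω) ∂μ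
        - β / 2 * ∫ ω, ‖Q.globalGradRep (avg (φ ω)) (θ ω)‖ ^ 2 ∂μ
        + (β * L ^ 2 / 2 * ∫ ω, dispersion (φ ω) ∂μ + L * β ^ 2 * σ ^ 2 / (2 * N)) := by
  have hz := hφ.prodMk hθ
  have hloss := (hz.comp fun z => Q.globalLoss (avg z.1) z.2).integrable (μ := μ) hS.measurable
  have hgrad := (hz.comp fun z => ‖Q.globalGradRep (avg z.1) z.2‖ ^ 2).integrable (μ := μ)
    hS.measurable
  have hdisp := (hφ.comp dispersion).integrable (μ := μ) hS.measurable
  refine (hz.integral_comp_le (determinedBy_repBatches k) disjoint_past_repIndices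
    hS.measurable hS.indep (fun z B => Q.globalLoss
      (avg z.1 - β • avg fun i => Q.batchGradRep i (B i) (z.1 i) (z.2 i)) z.2) _
    fun z => integral_globalLoss_sub_smul_avg_batchGradRep_le hL0 hβ hLβ hQ hL hS hU hV k
      z.1 z.2).trans_eq ?_
  simp (disch := fun_prop) only [integral_add, integral_sub, integral_const_mul, integral_const,
    probReal_univ, one_smul]

lemma integral_dispersion_batchGradRep_comp_le [NeZero N] (hL : Q.LipschitzGradients L)
    (hS : S.IsIndependentSampling μ τ) (hU : S.Unbiased μ τ) (hV : S.BoundedVariance μ τ σ)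
    (hς : Q.BoundedVariability ς) (hφ : DeterminedBy (S.family τ) (past N τ k τ) φ)
    (hθ : DeterminedBy (S.family τ) (past N τ k τ) θ) :
    ∫ ω, dispersion (fun i => Q.batchGradRep i (S.repBatch i k ω) (φ ω i) (θ ω i)) ∂μ
      ≤ σ ^ 2 + 2 * (ς ^ 2 + L ^ 2 * ∫ ω, dispersion (φ ω) ∂μ) := by
  have hdisp := (hφ.comp dispersion).integrable (μ := μ) hS.measurable
  refine ((hφ.prodMk hθ).integral_comp_le (determinedBy_repBatches k) disjoint_past_repIndices
    hS.measurable hS.indep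
    (fun z B => dispersion fun i => Q.batchGradRep i (B i) (z.1 i) (z.2 i)) _
    fun z => integral_dispersion_batchGradRep_le hL hS hU hV hς k z.1 z.2).trans_eq ?_
  simp (disch := fun_prop) only [integral_add, integral_const_mul, integral_const,
    probReal_univ, one_smul]

end RepStep

section Iterates

variable {N a b : ℕ} {X Z W Y Ω : Type*} {Q : Problem N a b X Z W Y} {S : Batches Q Ω}
  {τ : ℕ} {L σ ς α β : ℝ}

section HeadRound

variable [MeasurableSpace Ω] {μ : Measure Ω} [IsProbabilityMeasure μ] {k : ℕ}
  {φ : Ω → Fin N → Vec a} {x : Ω → Vec a} {θ : Ω → Fin N → Vec b}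

lemma integral_globalLoss_eq_avg {T : Finset (Fin N × ℕ × Option (Fin τ))}
    (hS : S.IsIndependentSampling μ τ) (hx : DeterminedBy (S.family τ) T x)
    (hθ : DeterminedBy (S.family τ) T θ) :
    ∫ ω, Q.globalLoss (x ω) (θ ω) ∂μ = avg fun i => ∫ ω, Q.localLoss i (x ω) (θ ω i) ∂μ := by
  simp only [Problem.globalLoss_eq_avg]
  exact integral_avg fun i => ((hx.prodMk hθ).comp
    fun z => Q.localLoss i z.1 (z.2 i)).integrable hS.measurable

lemma integral_dispersion_eq_avg {T : Finset (Fin N × ℕ × Option (Fin τ))}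
    (hS : S.IsIndependentSampling μ τ) (hφ : DeterminedBy (S.family τ) T φ) :
    ∫ ω, dispersion (φ ω) ∂μ = avg fun i => ∫ ω, ‖φ ω i - avg (φ ω)‖ ^ 2 ∂μ :=
  integral_avg fun i => (hφ.comp fun p => ‖p i - avg p‖ ^ 2).integrable hS.measurable

lemma integral_norm_globalGradHead_sq_le [NeZero N] {T : Finset (Fin N × ℕ × Option (Fin τ))}
    (hS : S.IsIndependentSampling μ τ) (hx : DeterminedBy (S.family τ) T x)
    (hθ : DeterminedBy (S.family τ) T θ) :
    ∫ ω, ‖Q.globalGradHead (x ω) (θ ω)‖ ^ 2 ∂μ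
      ≤ avg fun i => ∫ ω, ‖Q.gradHead i (x ω) (θ ω i)‖ ^ 2 ∂μ := by
  have hz := hx.prodMk hθ
  rw [← integral_avg fun i =>
    (hz.comp fun z => ‖Q.gradHead i z.1 (z.2 i)‖ ^ 2).integrable hS.measurable]
  exact integral_mono ((hz.comp fun z => ‖Q.globalGradHead z.1 z.2‖ ^ 2).integrable hS.measurable)
    ((hz.comp fun z => avg fun i => ‖Q.gradHead i z.1 (z.2 i)‖ ^ 2).integrable hS.measurable)
    fun ω => Problem.norm_globalGradHead_sq_le (x ω) (θ ω)

lemma integral_globalLoss_headIterate_le [NeZero N] (hL0 : 0 ≤ L) (hα : 0 ≤ α) (hτ : 1 ≤ τ)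
    (hατ : L * (α * τ) ≤ 1 / 2) (hQ : Q.PartiallyDifferentiable) (hL : Q.LipschitzGradients L)
    (hS : S.IsIndependentSampling μ τ) (hU : S.Unbiased μ τ) (hV : S.BoundedVariance μ τ σ)
    (hφ : DeterminedBy (S.family τ) (past N τ k 0) φ)
    (hθ : DeterminedBy (S.family τ) (past N τ k 0) θ) :
    ∫ ω, Q.globalLoss (avg (φ ω)) (fun i => headIterate Q S α i k ω (φ ω i) (θ ω i) τ) ∂μ
      ≤ ∫ ω, Q.globalLoss (avg (φ ω)) (θ ω) ∂μ
        - α * τ / 4 * ∫ ω, ‖Q.globalGradHead (avg (φ ω)) (θ ω)‖ ^ 2 ∂μ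
        + α * τ * L ^ 2 / 2 * ∫ ω, dispersion (φ ω) ∂μ
        + (L * α ^ 2 * τ / 2 + α ^ 3 * τ ^ 3 * L ^ 2 / 2) * σ ^ 2 := by
  have hx : DeterminedBy (S.family τ) (past N τ k 0) fun ω => avg (φ ω) := hφ.comp avg
  have hθ' : DeterminedBy (S.family τ) (past N τ k τ)
      fun ω i => headIterate Q S α i k ω (φ ω i) (θ ω i) τ :=
    .pi fun i => (hφ.comp fun p => p i).headIterate (hθ.comp fun p => p i) le_rfl
  have hlocal := avg_mono fun i => integral_localLoss_headIterate_le hL0 hα hτ hατ hQ hL hS hU hV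
    i k (hφ.comp fun p => p i) hx (hθ.comp fun p => p i)
  rw [avg_add, avg_add, avg_sub, avg_mul, avg_mul, avg_const, ← integral_globalLoss_eq_avg hS hx hθ,
    ← integral_globalLoss_eq_avg hS (hx.mono (past_mono τ.zero_le)) hθ',
    ← integral_dispersion_eq_avg hS hφ] at hlocal
  refine hlocal.trans ?_
  gcongr
  exact integral_norm_globalGradHead_sq_le hS hx hθ

end HeadRound

variable {G : Digraph (Fin N)} {P : Matrix (Fin N) (Fin N) ℝ} {φ₀ : Vec a} {θ₀ : Fin N → Vec b}

local notation "Φ" => repAt Q S G P α β τ φ₀ θ₀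

local notation "Θ" => headAt Q S G P α β τ φ₀ θ₀

lemma avg_repAt_zero [NeZero N] (ω : Ω) : avg (Φ 0 ω) = φ₀ :=
  avg_const φ₀

lemma meanRep_eq_avg (k : ℕ) (ω : Ω) : meanRep Q S G P α β τ φ₀ θ₀ k ω = avg (Φ k ω) := by
  rw [avg, Fintype.card_fin, meanRep]

lemma measureM_eq (k : ℕ) (ω : Ω) : measureM Q S G P α β τ φ₀ θ₀ k ω
    = ‖Q.globalGradRep (avg (Φ k ω)) (Θ (k + 1) ω)‖ ^ 2
      + α * τ / β * ‖Q.globalGradHead (avg (Φ k ω)) (Θ k ω)‖ ^ 2 + dispersion (Φ k ω) := by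
  simp only [measureM, meanRep_eq_avg, dispersion, avg, Fintype.card_fin, smul_eq_mul]

lemma IsConsensusMatrix.avg_repAt_succ (hP : IsConsensusMatrix G P) (k : ℕ) (ω : Ω) :
    avg (Φ (k + 1) ω) = avg (Φ k ω)
      - β • avg fun i => Q.batchGradRep i (S.repBatch i k ω) (Φ k ω i) (Θ (k + 1) ω i) :=
  hP.avg_step _ _ β

lemma determinedBy_headAt_succ {k : ℕ} (hφ : DeterminedBy (S.family τ) (past N τ k 0) (Φ k))
    (hθ : DeterminedBy (S.family τ) (past N τ k 0) (Θ k)) :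
    DeterminedBy (S.family τ) (past N τ k τ) (Θ (k + 1)) :=
  .pi fun i => (hφ.comp fun p => p i).headIterate (hθ.comp fun p => p i) le_rfl

lemma determinedBy_iterate (k : ℕ) : DeterminedBy (S.family τ) (past N τ k 0) (Φ k) ∧
    DeterminedBy (S.family τ) (past N τ k 0) (Θ k) := by
  induction k with
  | zero => exact ⟨fun _ _ _ => rfl, fun _ _ _ => rfl⟩
  | succ k ih =>
    have hθ := (determinedBy_headAt_succ ih.1 ih.2).mono past_subset_succ
    have hB : DeterminedBy (S.family τ) (past N τ (k + 1) 0) fun ω i => S.repBatch i k ω :=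
      (determinedBy_repBatches k).mono repIndices_subset_past
    exact ⟨(hB.prodMk ((ih.1.mono past_subset_succ).prodMk hθ)).comp fun z i =>
      ∑ j ∈ neighbors G i,
        P i j • (z.2.1 j - β • Q.batchGradRep j (z.1 j) (z.2.1 j) (z.2.2 j)), hθ⟩

variable [MeasurableSpace Ω] {μ : Measure Ω} [IsProbabilityMeasure μ]

lemma integral_globalLoss_succ_le [NeZero N] (hL0 : 0 ≤ L) (hα : 0 ≤ α) (hβ : 0 ≤ β)
    (hτ : 1 ≤ τ) (hατ : L * (α * τ) ≤ 1 / 2) (hLβ : L * β ≤ 1) (hP : IsConsensusMatrix G P)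
    (hQ : Q.PartiallyDifferentiable) (hL : Q.LipschitzGradients L)
    (hS : S.IsIndependentSampling μ τ) (hU : S.Unbiased μ τ) (hV : S.BoundedVariance μ τ σ)
    (k : ℕ) :
    ∫ ω, Q.globalLoss (avg (Φ (k + 1) ω)) (Θ (k + 1) ω) ∂μ
      ≤ ∫ ω, Q.globalLoss (avg (Φ k ω)) (Θ k ω) ∂μ
        - β / 2 * ∫ ω, ‖Q.globalGradRep (avg (Φ k ω)) (Θ (k + 1) ω)‖ ^ 2 ∂μ
        - α * τ / 4 * ∫ ω, ‖Q.globalGradHead (avg (Φ k ω)) (Θ k ω)‖ ^ 2 ∂μ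
        + (β + α * τ) * L ^ 2 / 2 * ∫ ω, dispersion (Φ k ω) ∂μ
        + (L * β ^ 2 * σ ^ 2 / (2 * N)
          + (L * α ^ 2 * τ / 2 + α ^ 3 * τ ^ 3 * L ^ 2 / 2) * σ ^ 2) := by
  obtain ⟨hφ, hθ⟩ : DeterminedBy (S.family τ) _ (Φ k) ∧ DeterminedBy (S.family τ) _ (Θ k) :=
    determinedBy_iterate k
  have hrep := integral_globalLoss_rep_step_le hL0 hβ hLβ hQ hL hS hU hV
    (hφ.mono (past_mono τ.zero_le)) (determinedBy_headAt_succ hφ hθ)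
  have hhead : ∫ ω, Q.globalLoss (avg (Φ k ω)) (Θ (k + 1) ω) ∂μ ≤ _ :=
    integral_globalLoss_headIterate_le (θ := Θ k) hL0 hα hτ hατ hQ hL hS hU hV hφ hθ
  simp only [← hP.avg_repAt_succ] at hrep
  linarith

lemma integral_dispersion_succ_le [NeZero N] (hN : 2 ≤ N) (hG : StronglyConnected G)
    (hP : IsConsensusMatrix G P) (hL : Q.LipschitzGradients L) (hS : S.IsIndependentSampling μ τ)
    (hU : S.Unbiased μ τ) (hV : S.BoundedVariance μ τ σ) (hς : Q.BoundedVariability ς) (k : ℕ) :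
    ∫ ω, dispersion (Φ (k + 1) ω) ∂μ
      ≤ (1 - gap P / 2) * ∫ ω, dispersion (Φ k ω) ∂μ
        + 2 / gap P * (β ^ 2 * (σ ^ 2 + 2 * (ς ^ 2 + L ^ 2 * ∫ ω, dispersion (Φ k ω) ∂μ))) := by
  obtain ⟨hφ, hθ⟩ : DeterminedBy (S.family τ) _ (Φ k) ∧ DeterminedBy (S.family τ) _ (Θ k) :=
    determinedBy_iterate k
  have hφ_succ : DeterminedBy (S.family τ) _ (Φ (k + 1)) := (determinedBy_iterate (k + 1)).1
  have hθ_succ : DeterminedBy (S.family τ) (past N τ k τ) (Θ (k + 1)) :=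
    determinedBy_headAt_succ hφ hθ
  set g : Ω → Fin N → Vec a := fun ω i =>
    Q.batchGradRep i (S.repBatch i k ω) (Φ k ω i) (Θ (k + 1) ω i)
  have hg : DeterminedBy (S.family τ) (past N τ (k + 1) 0) g :=
    (((determinedBy_repBatches k).mono repIndices_subset_past).prodMk
      ((hφ.mono past_subset_succ).prodMk (hθ_succ.mono past_subset_succ))).comp fun z i =>
        Q.batchGradRep i (z.1 i) (z.2.1 i) (z.2.2 i)
  have hdisp := (hφ.comp dispersion).integrable (μ := μ) hS.measurable
  have hdispg := (hg.comp dispersion).integrable (μ := μ) hS.measurable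
  have hgap := hP.gap_pos
  calc ∫ ω, dispersion (Φ (k + 1) ω) ∂μ
      ≤ ∫ ω, ((1 - gap P / 2) * dispersion (Φ k ω)
          + 2 / gap P * (β ^ 2 * dispersion (g ω))) ∂μ :=
        integral_mono ((hφ_succ.comp dispersion).integrable hS.measurable)
          ((hdisp.const_mul _).add ((hdispg.const_mul _).const_mul _))
          fun ω => hP.dispersion_step_le hN hG (Φ k ω) (g ω) β
    _ = (1 - gap P / 2) * ∫ ω, dispersion (Φ k ω) ∂μ
          + 2 / gap P * (β ^ 2 * ∫ ω, dispersion (g ω) ∂μ) := by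
        simp (disch := fun_prop) only [integral_add, integral_const_mul]
    _ ≤ _ := by
        gcongr
        exact integral_dispersion_batchGradRep_comp_le hL hS hU hV hς
          (hφ.mono (past_mono τ.zero_le)) hθ_succ

lemma integrable_terms_measureM (hS : S.IsIndependentSampling μ τ) (k : ℕ) :
    Integrable (fun ω => ‖Q.globalGradRep (avg (Φ k ω)) (Θ (k + 1) ω)‖ ^ 2) μ ∧
    Integrable (fun ω => ‖Q.globalGradHead (avg (Φ k ω)) (Θ k ω)‖ ^ 2) μ ∧
    Integrable (fun ω => dispersion (Φ k ω)) μ := by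
  obtain ⟨hφ, hθ⟩ : DeterminedBy (S.family τ) _ (Φ k) ∧ DeterminedBy (S.family τ) _ (Θ k) :=
    determinedBy_iterate k
  exact ⟨(((hφ.mono (past_mono τ.zero_le)).prodMk (determinedBy_headAt_succ hφ hθ)).comp
      fun z => ‖Q.globalGradRep (avg z.1) z.2‖ ^ 2).integrable hS.measurable,
    ((hφ.prodMk hθ).comp fun z => ‖Q.globalGradHead (avg z.1) z.2‖ ^ 2).integrable hS.measurable,
    (hφ.comp dispersion).integrable hS.measurable⟩

lemma integrable_measureM (hS : S.IsIndependentSampling μ τ) (k : ℕ) :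
    Integrable (measureM Q S G P α β τ φ₀ θ₀ k) μ := by
  obtain ⟨hrep, hhead, hdisp⟩ := integrable_terms_measureM (G := G) (P := P) (α := α) (β := β)
    (φ₀ := φ₀) (θ₀ := θ₀) hS k
  exact ((hrep.add (hhead.const_mul _)).add hdisp).congr
    (.of_forall fun ω => (measureM_eq k ω).symm)

lemma integral_measureM (hS : S.IsIndependentSampling μ τ) (k : ℕ) :
    ∫ ω, measureM Q S G P α β τ φ₀ θ₀ k ω ∂μ
      = ∫ ω, ‖Q.globalGradRep (avg (Φ k ω)) (Θ (k + 1) ω)‖ ^ 2 ∂μ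
        + α * τ / β * ∫ ω, ‖Q.globalGradHead (avg (Φ k ω)) (Θ k ω)‖ ^ 2 ∂μ
        + ∫ ω, dispersion (Φ k ω) ∂μ := by
  obtain ⟨hrep, hhead, hdisp⟩ := integrable_terms_measureM (G := G) (P := P) (α := α) (β := β)
    (φ₀ := φ₀) (θ₀ := θ₀) hS k
  simp only [measureM_eq]
  simp (disch := fun_prop) only [integral_add, integral_const_mul]

end Iterates

section Recursions

variable {A B D f : ℕ → ℝ} {β γ κ ν δ e c r M fStar : ℝ}

lemma sum_le_of_descent (hβ : 0 < β) (hγ : γ ≤ β) (hA : ∀ k, 0 ≤ A k) (hD : ∀ k, 0 ≤ D k)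
    (hDM : ∀ k, D k ≤ M)
    (hf : ∀ k, f (k + 1) ≤ f k - β / 2 * A k - γ / 4 * B k + (β + γ) * κ ^ 2 / 2 * D k + r)
    (K : ℕ) (hfK : fStar ≤ f K) :
    ∑ k ∈ Finset.range K, (A k + γ / β * B k + D k)
      ≤ 4 / β * (f 0 - fStar) + K * (4 / β * r + (4 * κ ^ 2 + 1) * M) := by
  have hstep (k) : A k + γ / β * B k + D k
      ≤ 4 / β * (f k - f (k + 1)) + (4 / β * r + (4 * κ ^ 2 + 1) * M) := by
    have hpert : (β + γ) * κ ^ 2 / 2 * D k ≤ β * κ ^ 2 * M := by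
      calc (β + γ) * κ ^ 2 / 2 * D k ≤ (β + β) * κ ^ 2 / 2 * M := by
            gcongr
            exacts [hD k, hDM k]
        _ = β * κ ^ 2 * M := by ring
    have hdecr : β / 4 * A k + γ / 4 * B k ≤ (f k - f (k + 1)) + r + β * κ ^ 2 * M := by
      linarith [hf k, mul_nonneg hβ.le (hA k)]
    calc A k + γ / β * B k + D k = 4 / β * (β / 4 * A k + γ / 4 * B k) + D k := by field_simp
      _ ≤ 4 / β * ((f k - f (k + 1)) + r + β * κ ^ 2 * M) + M := by
          gcongr
          exact hDM k
      _ = _ := by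
          field_simp
          ring
  calc ∑ k ∈ Finset.range K, (A k + γ / β * B k + D k)
      ≤ ∑ k ∈ Finset.range K,
          (4 / β * (f k - f (k + 1)) + (4 / β * r + (4 * κ ^ 2 + 1) * M)) :=
        Finset.sum_le_sum fun k _ => hstep k
    _ = 4 / β * (f 0 - f K) + K * (4 / β * r + (4 * κ ^ 2 + 1) * M) := by
        rw [Finset.sum_add_distrib, ← Finset.mul_sum, Finset.sum_range_sub',
          Finset.sum_const, Finset.card_range, nsmul_eq_mul]
    _ ≤ _ := by gcongr

lemma le_of_contraction (hδ : 0 < δ) (hδ4 : δ ≤ 4) (he : 0 ≤ e) (hc : c ≤ δ / 4)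
    (hD : ∀ k, 0 ≤ D k) (hD0 : D 0 = 0)
    (hstep : ∀ k, D (k + 1) ≤ (1 - δ / 2) * D k + (e + c * D k)) (k : ℕ) : D k ≤ 4 * e / δ := by
  induction k with
  | zero =>
    rw [hD0]
    positivity
  | succ k ih =>
    calc D (k + 1) ≤ (1 - δ / 2) * D k + (e + δ / 4 * D k) := by
          refine (hstep k).trans ?_
          gcongr
          exact hD k
      _ = (1 - δ / 4) * D k + e := by ring
      _ ≤ (1 - δ / 4) * (4 * e / δ) + e := by
          gcongr
          linarith
      _ = 4 * e / δ := by field_simp; ring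

end Recursions

section Convergence

variable {N a b : ℕ} {X Z W Y Ω : Type*} {Q : Problem N a b X Z W Y} {S : Batches Q Ω}
  {τ : ℕ} {L σ ς α β : ℝ} {G : Digraph (Fin N)} {P : Matrix (Fin N) (Fin N) ℝ}
  {φ₀ : Vec a} {θ₀ : Fin N → Vec b} [MeasurableSpace Ω] {μ : Measure Ω} [IsProbabilityMeasure μ]

local notation "Φ" => repAt Q S G P α β τ φ₀ θ₀

local notation "Θ" => headAt Q S G P α β τ φ₀ θ₀

lemma integral_dispersion_le [NeZero N] (hL0 : 0 ≤ L) (hβ : 0 ≤ β) (hLβ : 4 * L * β ≤ gap P)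
    (hN : 2 ≤ N) (hG : StronglyConnected G) (hP : IsConsensusMatrix G P)
    (hL : Q.LipschitzGradients L) (hS : S.IsIndependentSampling μ τ) (hU : S.Unbiased μ τ)
    (hV : S.BoundedVariance μ τ σ) (hς : Q.BoundedVariability ς) (k : ℕ) :
    ∫ ω, dispersion (Φ k ω) ∂μ ≤ 8 * β ^ 2 * (σ ^ 2 + 2 * ς ^ 2) / gap P ^ 2 := by
  have hgap := hP.gap_pos
  have hcoeff : 4 * β ^ 2 * L ^ 2 / gap P ≤ gap P / 4 := by
    rw [div_le_div_iff₀ hgap four_pos]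
    calc 4 * β ^ 2 * L ^ 2 * 4 = (4 * L * β) * (4 * L * β) := by ring
      _ ≤ gap P * gap P := by gcongr
  have hzero : ∫ ω, dispersion (Φ 0 ω) ∂μ = 0 := by
    simp [dispersion, avg_repAt_zero, repAt, iterate, avg_const]
  refine (le_of_contraction (D := fun k => ∫ ω, dispersion (Φ k ω) ∂μ)
    (e := 2 * β ^ 2 * (σ ^ 2 + 2 * ς ^ 2) / gap P) hgap ?_ (by positivity) hcoeff
    (fun k => integral_nonneg fun ω => dispersion_nonneg _) hzero (fun k => ?_) k).trans_eq ?_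
  · linarith [hP.gap_le hN hG]
  · exact (integral_dispersion_succ_le hN hG hP hL hS hU hV hς k).trans_eq (by ring)
  · ring

lemma le_integral_globalLoss {fStar : ℝ} (hf : ∀ φ θ, fStar ≤ Q.globalLoss φ θ)
    (hS : S.IsIndependentSampling μ τ) (k : ℕ) :
    fStar ≤ ∫ ω, Q.globalLoss (avg (Φ k ω)) (Θ k ω) ∂μ := by
  obtain ⟨hφ, hθ⟩ : DeterminedBy (S.family τ) _ (Φ k) ∧ DeterminedBy (S.family τ) _ (Θ k) :=
    determinedBy_iterate k
  have hint := ((hφ.prodMk hθ).comp fun z => Q.globalLoss (avg z.1) z.2).integrable (μ := μ)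
    hS.measurable
  simpa using integral_mono (integrable_const fStar) hint fun ω => hf (avg (Φ k ω)) (Θ k ω)

lemma averageM_le {fStar : ℝ} {K : ℕ} (hK : 0 < K) (hL0 : 0 ≤ L) (hα : 0 ≤ α) (hβ : 0 < β)
    (hατ : α * τ ≤ β) (hLβ : 4 * L * β ≤ gap P) (hN : 2 ≤ N) (hτ : 1 ≤ τ)
    (hG : StronglyConnected G) (hP : IsConsensusMatrix G P) (hQ : Q.PartiallyDifferentiable)
    (hL : Q.LipschitzGradients L) (hS : S.IsIndependentSampling μ τ) (hU : S.Unbiased μ τ)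
    (hV : S.BoundedVariance μ τ σ) (hς : Q.BoundedVariability ς)
    (hf : ∀ φ θ, fStar ≤ Q.globalLoss φ θ) :
    averageM Q S G P α β τ φ₀ θ₀ μ K
      ≤ 4 * (Q.globalLoss φ₀ θ₀ - fStar) / (β * K)
        + 4 / β * (L * β ^ 2 * σ ^ 2 / (2 * N)
          + (L * α ^ 2 * τ / 2 + α ^ 3 * τ ^ 3 * L ^ 2 / 2) * σ ^ 2)
        + (4 * L ^ 2 + 1) * (8 * β ^ 2 * (σ ^ 2 + 2 * ς ^ 2) / gap P ^ 2) := by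
  have : NeZero N := ⟨by omega⟩
  have hgap : gap P ≤ 1 / 16 := hP.gap_le hN hG
  have hLατ : L * (α * τ) ≤ 1 / 2 := by linarith [mul_le_mul_of_nonneg_left hατ hL0]
  have hinit : ∫ ω, Q.globalLoss (avg (Φ 0 ω)) (Θ 0 ω) ∂μ = Q.globalLoss φ₀ θ₀ := by
    simp [avg_repAt_zero, show ∀ ω, Θ 0 ω = θ₀ from fun _ => rfl]
  have hsum := sum_le_of_descent (f := fun k => ∫ ω, Q.globalLoss (avg (Φ k ω)) (Θ k ω) ∂μ)
    hβ hατ (fun k => integral_nonneg fun ω => sq_nonneg _)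
    (fun k => integral_nonneg fun ω => dispersion_nonneg _)
    (integral_dispersion_le hL0 hβ.le hLβ hN hG hP hL hS hU hV hς)
    (integral_globalLoss_succ_le hL0 hα hβ.le hτ hLατ (by linarith)
      hP hQ hL hS hU hV) K (le_integral_globalLoss hf hS K)
  simp only [averageM, integral_measureM hS]
  calc _ ≤ 1 / (K : ℝ) * _ := mul_le_mul_of_nonneg_left hsum (by positivity)
    _ = _ := by
        rw [hinit]
        field_simp
        ring

end Convergence

section Rate

variable {N K : ℕ} {L : ℝ} {G : Digraph (Fin N)} {P : Matrix (Fin N) (Fin N) ℝ}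

lemma IsConsensusMatrix.rounds_pos (hP : IsConsensusMatrix G P) (hN : 2 ≤ N)
    (hG : StronglyConnected G) (hL : 0 < L)
    (hK : 18 * constC P ^ 2 * L ^ 2 * (N : ℝ) ^ 3 / (1 - constQ P) ^ 2 ≤ K) : 0 < K := by
  have hC := hP.constC_pos hN hG
  have hq : 0 < 1 - constQ P := sub_pos.2 (hP.constQ_lt_one hN hG)
  exact Nat.cast_pos.1 (lt_of_lt_of_le (by positivity) hK)

lemma IsConsensusMatrix.mul_sqrt_div_le_one (hP : IsConsensusMatrix G P) (hN : 2 ≤ N)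
    (hG : StronglyConnected G) (hL : 0 ≤ L)
    (hK : 18 * constC P ^ 2 * L ^ 2 * (N : ℝ) ^ 3 / (1 - constQ P) ^ 2 ≤ K) :
    4 * (constC P / (1 - constQ P)) * L * N * √(N / K) ≤ 1 := by
  have hC := hP.constC_pos hN hG
  have hq : 0 < 1 - constQ P := sub_pos.2 (hP.constQ_lt_one hN hG)
  rw [← sq_le_one_iff₀ (by positivity), mul_pow, Real.sq_sqrt (by positivity)]
  calc (4 * (constC P / (1 - constQ P)) * L * N) ^ 2 * (N / K)
      = 16 * (constC P ^ 2 * L ^ 2 * (N : ℝ) ^ 3 / (1 - constQ P) ^ 2) / K := by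
        simp only [mul_pow, div_pow]
        ring
    _ ≤ 18 * (constC P ^ 2 * L ^ 2 * (N : ℝ) ^ 3 / (1 - constQ P) ^ 2) / K := by
        gcongr
        norm_num
    _ = 18 * constC P ^ 2 * L ^ 2 * (N : ℝ) ^ 3 / (1 - constQ P) ^ 2 / K := by ring
    _ ≤ 1 := div_le_one_of_le₀ hK K.cast_nonneg

lemma IsConsensusMatrix.mul_sqrt_div_le_gap (hP : IsConsensusMatrix G P) (hN : 2 ≤ N)
    (hG : StronglyConnected G) (hL : 0 ≤ L)
    (hK : 18 * constC P ^ 2 * L ^ 2 * (N : ℝ) ^ 3 / (1 - constQ P) ^ 2 ≤ K) :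
    4 * L * √(N / K) ≤ gap P := by
  have : NeZero N := ⟨by omega⟩
  have hgap := hP.gap_pos
  have hN' : (2 : ℝ) ≤ N := by exact_mod_cast hN
  have hsq : 4 * L * N * √(N / K) ≤ 32 * gap P ^ 2 := by
    calc 4 * L * N * √(N / K) = 1 / gap P ^ 2 * (gap P ^ 2 * (4 * L * N * √(N / K))) := by
          field_simp
      _ ≤ 32 * (constC P / (1 - constQ P)) * (gap P ^ 2 * (4 * L * N * √(N / K))) := by
          gcongr
          exact hP.one_div_gap_sq_le hN hG
      _ = 32 * gap P ^ 2 * (4 * (constC P / (1 - constQ P)) * L * N * √(N / K)) := by ring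
      _ ≤ 32 * gap P ^ 2 * 1 := by
          gcongr
          exact hP.mul_sqrt_div_le_one hN hG hL hK
      _ = 32 * gap P ^ 2 := mul_one _
  calc 4 * L * √(N / K) = 4 * L * 2 * √(N / K) / 2 := by ring
    _ ≤ 4 * L * N * √(N / K) / 2 := by gcongr
    _ ≤ 32 * gap P ^ 2 / 2 := by gcongr
    _ = 16 * gap P * gap P := by ring
    _ ≤ 1 * gap P := by
        gcongr
        linarith [hP.gap_le hN hG]
    _ = gap P := one_mul _

lemma sqrt_div_div_eq (hN : 0 < N) (hK : 0 < K) :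
    √((N : ℝ) / K) / N = 1 / √((N : ℝ) * K) := by
  have : 0 < √(N : ℝ) := by positivity
  rw [Real.sqrt_div N.cast_nonneg, Real.sqrt_mul N.cast_nonneg]
  field_simp
  rw [Real.sq_sqrt N.cast_nonneg]

lemma IsConsensusMatrix.div_gap_sq_le (hP : IsConsensusMatrix G P) (hN : 2 ≤ N)
    (hG : StronglyConnected G) (hL : 0 < L)
    (hK : 18 * constC P ^ 2 * L ^ 2 * (N : ℝ) ^ 3 / (1 - constQ P) ^ 2 ≤ K) :
    √(N / K) ^ 2 / gap P ^ 2 ≤ 8 / L * (1 / √((N : ℝ) * K)) := by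
  have : (0 : ℝ) < N := by positivity
  calc √(N / K) ^ 2 / gap P ^ 2 = √(N / K) ^ 2 * (1 / gap P ^ 2) := by ring
    _ ≤ √(N / K) ^ 2 * (32 * (constC P / (1 - constQ P))) := by
        gcongr
        exact hP.one_div_gap_sq_le hN hG
    _ = 8 / L * (√(N / K) / N) * (4 * (constC P / (1 - constQ P)) * L * N * √(N / K)) := by
        field_simp
        ring
    _ ≤ 8 / L * (√(N / K) / N) * 1 := by
        gcongr
        exact hP.mul_sqrt_div_le_one hN hG hL.le hK
    _ = 8 / L * (1 / √((N : ℝ) * K)) := by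
        rw [sqrt_div_div_eq (by omega) (hP.rounds_pos hN hG hL hK), mul_one]

lemma sqrt_mul_le_mul_sqrt (hK : 0 < K) : √((N : ℝ) * K) ≤ K * √N := by
  rw [Real.sqrt_mul N.cast_nonneg, mul_comm]
  gcongr
  exact Real.sqrt_le_self_iff.2 (.inr (by exact_mod_cast hK))

/-- The constant `c` of the convergence rate; the summand `1` keeps it positive even if `Δ`, `σ`
and `ς` vanish. -/
def rateConst (L σ ς Δ : ℝ) : ℝ :=
  4 * |Δ| + 2 * L * σ ^ 2 + 2 * L ^ 2 * σ ^ 2 + 64 * (4 * L ^ 2 + 1) * (σ ^ 2 + 2 * ς ^ 2) / L + 1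

lemma rateConst_pos (hL : 0 < L) (σ ς Δ : ℝ) : 0 < rateConst L σ ς Δ := by
  unfold rateConst
  positivity

variable {a b τ : ℕ} {X Z W Y Ω : Type*} {Q : Problem N a b X Z W Y} {S : Batches Q Ω}
  {σ ς Δ fStar : ℝ} {φ₀ : Vec a} {θ₀ : Fin N → Vec b} [MeasurableSpace Ω] {μ : Measure Ω}
  [IsProbabilityMeasure μ]

lemma averageM_le_of_rounds (hL0 : 0 < L) (hN : 2 ≤ N) (hτ : 1 ≤ τ)
    (hG : StronglyConnected G) (hP : IsConsensusMatrix G P) (hQ : Q.PartiallyDifferentiable)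
    (hL : Q.LipschitzGradients L) (hS : S.IsIndependentSampling μ τ) (hU : S.Unbiased μ τ)
    (hV : S.BoundedVariance μ τ σ) (hς : Q.BoundedVariability ς)
    (hf : ∀ φ θ, fStar ≤ Q.globalLoss φ θ)
    (hK : 18 * constC P ^ 2 * L ^ 2 * (N : ℝ) ^ 3 / (1 - constQ P) ^ 2 ≤ K) :
    averageM Q S G P (1 / (τ * √K)) √(N / K) τ φ₀ θ₀ μ K
      ≤ (4 * (Q.globalLoss φ₀ θ₀ - fStar) + 2 * L * σ ^ 2
          + 64 * (4 * L ^ 2 + 1) * (σ ^ 2 + 2 * ς ^ 2) / L) * (1 / √((N : ℝ) * K))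
        + 2 * L ^ 2 * σ ^ 2 * (1 / (K * √N)) + 2 * L * σ ^ 2 * (1 / (τ * √((N : ℝ) * K))) := by
  have hK0 : 0 < K := hP.rounds_pos hN hG hL0 hK
  have hsK : 0 < √(K : ℝ) := by positivity
  have hsN : 0 < √(N : ℝ) := by positivity
  have hατ : 1 / (τ * √K) * τ ≤ √((N : ℝ) / K) := by
    calc 1 / (τ * √K) * τ = √1 / √K := by
          rw [Real.sqrt_one]
          field_simp
      _ ≤ √N / √K := by
          gcongr
          exact_mod_cast one_le_two.trans hN
      _ = √((N : ℝ) / K) := (Real.sqrt_div N.cast_nonneg _).symm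
  refine (averageM_le hK0 hL0.le (by positivity) (by positivity) hατ
    (hP.mul_sqrt_div_le_gap hN hG hL0.le hK) hN hτ hG hP hQ hL hS hU hV hς hf).trans ?_
  have hdisp : (4 * L ^ 2 + 1) * (8 * √(N / K) ^ 2 * (σ ^ 2 + 2 * ς ^ 2) / gap P ^ 2)
      ≤ 64 * (4 * L ^ 2 + 1) * (σ ^ 2 + 2 * ς ^ 2) / L * (1 / √((N : ℝ) * K)) := by
    calc _ = 8 * (4 * L ^ 2 + 1) * (σ ^ 2 + 2 * ς ^ 2) * (√(N / K) ^ 2 / gap P ^ 2) := by ring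
      _ ≤ 8 * (4 * L ^ 2 + 1) * (σ ^ 2 + 2 * ς ^ 2) * (8 / L * (1 / √((N : ℝ) * K))) := by
          gcongr ?_ * ?_
          exact hP.div_gap_sq_le hN hG hL0 hK
      _ = _ := by ring
  have hdescent : 4 * (Q.globalLoss φ₀ θ₀ - fStar) / (√(N / K) * K)
        + 4 / √(N / K) * (L * √(N / K) ^ 2 * σ ^ 2 / (2 * N)
          + (L * (1 / (τ * √K)) ^ 2 * τ / 2 + (1 / (τ * √K)) ^ 3 * τ ^ 3 * L ^ 2 / 2) * σ ^ 2)
      = (4 * (Q.globalLoss φ₀ θ₀ - fStar) + 2 * L * σ ^ 2) * (1 / √((N : ℝ) * K))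
        + 2 * L ^ 2 * σ ^ 2 * (1 / (K * √N)) + 2 * L * σ ^ 2 * (1 / (τ * √((N : ℝ) * K))) := by
    rw [Real.sqrt_mul N.cast_nonneg, Real.sqrt_div N.cast_nonneg]
    have hKsq : (K : ℝ) = √K ^ 2 := (Real.sq_sqrt K.cast_nonneg).symm
    have hNsq : (N : ℝ) = √N ^ 2 := (Real.sq_sqrt N.cast_nonneg).symm
    generalize √(K : ℝ) = x at *
    generalize √(N : ℝ) = y at *
    rw [hKsq, hNsq]
    field_simp
    ring
  linarith

lemma averageM_le_rateConst_mul (hL0 : 0 < L) (hN : 2 ≤ N) (hτ : 1 ≤ τ)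
    (hG : StronglyConnected G) (hP : IsConsensusMatrix G P) (hQ : Q.PartiallyDifferentiable)
    (hL : Q.LipschitzGradients L) (hS : S.IsIndependentSampling μ τ) (hU : S.Unbiased μ τ)
    (hV : S.BoundedVariance μ τ σ) (hς : Q.BoundedVariability ς)
    (hf : ∀ φ θ, fStar ≤ Q.globalLoss φ θ) (hΔ : Q.globalLoss φ₀ θ₀ - fStar ≤ Δ)
    (hK : 18 * constC P ^ 2 * L ^ 2 * (N : ℝ) ^ 3 / (1 - constQ P) ^ 2 ≤ K) :
    averageM Q S G P (1 / (τ * √K)) √(N / K) τ φ₀ θ₀ μ K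
      ≤ rateConst L σ ς Δ * (1 / √((N : ℝ) * K) + 1 / (K * √N) + 1 / (τ * √((N : ℝ) * K))) := by
  have hgap : 4 * (Q.globalLoss φ₀ θ₀ - fStar) ≤ 4 * |Δ| := by linarith [le_abs_self Δ]
  have hnoise : 0 ≤ 2 * L * σ ^ 2 := by positivity
  have hnoise_sq : 0 ≤ 2 * L ^ 2 * σ ^ 2 := by positivity
  have hdisp : 0 ≤ 64 * (4 * L ^ 2 + 1) * (σ ^ 2 + 2 * ς ^ 2) / L := by positivity
  refine (averageM_le_of_rounds hL0 hN hτ hG hP hQ hL hS hU hV hς hf hK).trans ?_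
  rw [mul_add (rateConst L σ ς Δ), mul_add (rateConst L σ ς Δ)]
  gcongr ?_ * _ + ?_ * _ + ?_ * _
  all_goals
    unfold rateConst
    linarith [abs_nonneg Δ]

end Rate

end DePRL

end

theorem corollary1_general {L σ ς Δ fStar : ℝ} {N a b τ K : ℕ} {X Z W Y Ω : Type*}
    [MeasurableSpace Ω] {μ : Measure Ω} [IsProbabilityMeasure μ]
    {Q : DePRL.Problem N a b X Z W Y} {S : DePRL.Batches Q Ω}
    {G : Digraph (Fin N)} {P : Matrix (Fin N) (Fin N) ℝ}
    {φ₀ : DePRL.Vec a} {θ₀ : Fin N → DePRL.Vec b}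
    (hL0 : 0 < L) (hN : 2 ≤ N) (hτ : 1 ≤ τ)
    (hG : DePRL.StronglyConnected G) (hP : DePRL.IsConsensusMatrix G P)
    (hQ : Q.PartiallyDifferentiable) (hL : Q.LipschitzGradients L)
    (hS : S.IsIndependentSampling μ τ) (hU : S.Unbiased μ τ) (hV : S.BoundedVariance μ τ σ)
    (hς : Q.BoundedVariability ς) (hf : ∀ φ θ, fStar ≤ Q.globalLoss φ θ)
    (hΔ : Q.globalLoss φ₀ θ₀ - fStar ≤ Δ)
    (hK : 18 * DePRL.constC P ^ 2 * L ^ 2 * (N : ℝ) ^ 3 / (1 - DePRL.constQ P) ^ 2 ≤ K) :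
    let α : ℝ := 1 / (τ * √K)
    let β : ℝ := √(N / K)
    let c : ℝ := DePRL.rateConst L σ ς Δ
    (∀ k, Integrable (DePRL.measureM Q S G P α β τ φ₀ θ₀ k) μ) ∧
    DePRL.averageM Q S G P α β τ φ₀ θ₀ μ K
      ≤ c * (1 / √((N : ℝ) * K) + 1 / (K * √N) + 1 / (τ * √((N : ℝ) * K))) ∧
    DePRL.averageM Q S G P α β τ φ₀ θ₀ μ K ≤ 3 * c / √((N : ℝ) * K) := by
  intro α β c
  have hK0 : 0 < K := hP.rounds_pos hN hG hL0 hK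
  have hc : 0 < c := DePRL.rateConst_pos hL0 σ ς Δ
  have hbound := DePRL.averageM_le_rateConst_mul hL0 hN hτ hG hP hQ hL hS hU hV hς
    hf hΔ hK
  refine ⟨DePRL.integrable_measureM hS, hbound, hbound.trans ?_⟩
  calc c * (1 / √((N : ℝ) * K) + 1 / (K * √N) + 1 / (τ * √((N : ℝ) * K)))
      ≤ c * (1 / √((N : ℝ) * K) + 1 / √((N : ℝ) * K) + 1 / √((N : ℝ) * K)) := by
        gcongr
        · exact DePRL.sqrt_mul_le_mul_sqrt hK0
        · exact le_mul_of_one_le_left (Real.sqrt_nonneg _) (by exact_mod_cast hτ)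
    _ = 3 * c / √((N : ℝ) * K) := by ring

theorem corollary1 (L σ ς Δ : ℝ) (hL : 0 < L) (hσ : 0 < σ) (hς : 0 < ς) :
    ∃ c : ℝ, 0 < c ∧
      ∀ (N a b : ℕ) (X Z W Y Ω : Type*) [MeasurableSpace Ω] (μ : MeasureTheory.Measure Ω)
        [MeasureTheory.IsProbabilityMeasure μ]
        (Q : DePRL.Problem N a b X Z W Y) (S : DePRL.Batches Q Ω)
        (G : Digraph (Fin N)) (P : Matrix (Fin N) (Fin N) ℝ) (τ K : ℕ)
        (φ₀ : DePRL.Vec a) (θ₀ : Fin N → DePRL.Vec b) (fStar : ℝ),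
        2 ≤ N → 1 ≤ τ →
        DePRL.StronglyConnected G →
        DePRL.IsConsensusMatrix G P →
        Q.PartiallyDifferentiable →
        Q.LipschitzGradients L →
        S.IsIndependentSampling μ τ →
        S.Unbiased μ τ →
        S.BoundedVariance μ τ σ →
        Q.BoundedVariability ς →
        IsGLB (Set.range fun x : DePRL.Vec a × (Fin N → DePRL.Vec b) => Q.globalLoss x.1 x.2)
          fStar →
        Q.globalLoss φ₀ θ₀ - fStar ≤ Δ →
        max (max (18 * DePRL.constC P ^ 2 * L ^ 2 * (N : ℝ) ^ 3 / (1 - DePRL.constQ P) ^ 2)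
            ((2 * L ^ 2 + 2) ^ 2 / ((N : ℝ) * L ^ 4))) ((N : ℝ) * L ^ 2) ≤ (K : ℝ) →
        let α : ℝ := 1 / ((τ : ℝ) * √(K : ℝ))
        let β : ℝ := √((N : ℝ) / (K : ℝ))
        (∀ k < K, MeasureTheory.Integrable (DePRL.measureM Q S G P α β τ φ₀ θ₀ k) μ) ∧
        DePRL.averageM Q S G P α β τ φ₀ θ₀ μ K ≤
          c * (1 / √((N : ℝ) * (K : ℝ)) + 1 / ((K : ℝ) * √(N : ℝ))
            + 1 / ((τ : ℝ) * √((N : ℝ) * (K : ℝ)))) ∧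
        DePRL.averageM Q S G P α β τ φ₀ θ₀ μ K ≤ 3 * c / √((N : ℝ) * (K : ℝ)) := by
  refine ⟨DePRL.rateConst L σ ς Δ, DePRL.rateConst_pos hL σ ς Δ, ?_⟩
  intro N a b X Z W Y Ω _ μ _ Q S G P τ K φ₀ θ₀ fStar hN hτ hG hP hQ hLip hS hU hV hvar hf hΔ hK
  exact (corollary1_general hL hN hτ hG hP hQ hLip hS hU hV hvar (fun φ θ => hf.1 ⟨(φ, θ), rfl⟩) hΔ
    (le_of_max_le_left (le_of_max_le_left hK))).imp_left fun hint k _ => hint k
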